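/- **Setting.** A biquandle is a set $X$ with two binary operations $\underline{*},\overline{*}$ such that: (1) $x\,\underline{*}\,x=x\,\overline{*}\,x$; (2) the maps $\bullet\,\underline{*}\,y$, $\bullet\,\overline{*}\,y$ on $X$ and $(x,y)\mapsto(y\,\overline{*}\,x,\;x\,\underline{*}\,y)$ on $X\times X$ are bijective; (3) $(x\underline{*}y)\underline{*}(z\underline{*}y)=(x\underline{*}z)\underline{*}(y\overline{*}z)$, $(x\overline{*}y)\overline{*}(z\overline{*}y)=(x\overline{*}z)\overline{*}(y\underline{*}z)$, $(x\underline{*}y)\overline{*}(z\underline{*}y)=(x\overline{*}z)\underline{*}(y\overline{*}z)$. Let $\overline{*}^{-1}$ denote the inverse operation, $(x\,\overline{*}\,y)\,\overline{*}^{-1}y=x$. The derived quandle $Q(X)$ is the set $X$ with $x*y=(x\,\underline{*}\,y)\,\overline{*}^{-1}y$. Let $D$ be a diagram of an oriented classical link, drawn in general position with respect to the height function and cut by horizontal lines into strips each containing exactly one crossing, maximum or minimum (every diagram is planar isotopic to such a one). Normal vectors of strings point to the left of the direction of travel; the specified region of a semi-arc is the one from which its normal vector points. At a crossing let $\sigma_i,\sigma_k$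 be the under and $\sigma_j,\sigma_l$ the over semi-arcs, $\sigma_i,\sigma_j$ being those adjacent to the region from which both normals point away. An $X$-coloring of $D$ is a map $C$ from semi-arcs to $X$ with $C(\sigma_i)\,\underline{*}\,C(\sigma_j)=C(\sigma_k)$ and $C(\sigma_j)\,\overline{*}\,C(\sigma_i)=C(\sigma_l)$ at every crossing. A $Q(X)$-coloring is a map $C$ from arcs to $Q(X)$ with $C(\sigma_i)*C(\sigma_j)=C(\sigma_k)$ at every crossing (evaluated on the arcs containing these semi-arcs). **Theorem.** For every biquandle $X$ and every diagram $D$ as above there are mutually inverse maps $\Psi$ from the $Q(X)$-colorings of $D$ to the $X$-colorings of $D$ and $\Phi$ in the other direction, with the following descriptions. (a) *Double, pull away, restrict.* Let $W(D)$ be the doubled diagram: $D$ together with a copy of $D$ of opposite orientation and opposite crossings, placed behind $D$ and pushed slightly in the normal direction. Let $D\sqcup -D^h$ be $D$ with, on its right, its mirror image in a vertical line with opposite orientation. For each $Q(X)$-coloring $C$ of $D$ there is exactly one $X$-coloring $C_1$ of $W(D)$ such that on each of the horizontal lines both strings of each parallel pair have the color given by $C$. On each line, move the leftmost copy string to the right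 end, under all other strings, then the second copy string to the left of the first, and so on, the colors changing by the biquandle coloring condition. There is exactly one $X$-coloring $C_2$ of $D\sqcup -D^h$ with the resulting colors on all these lines, and $\Psi(C)$ is the restriction of $C_2$ to $D$. (b) *Push out to the unbounded region.* Let $C$ be an $X$-coloring of $D$ and $\sigma$ a semi-arc. There is an arc $\gamma$ from the unbounded region to $\sigma$, missing crossings, transverse to $D$ and reaching $\sigma$ from its specified region; and for every such $\gamma$, pushing $\sigma$ out along $\gamma$ over all the strings that $\gamma$ crosses gives the head of the pushed-out semi-arc the well-defined color $\Phi(C)(\alpha)$, where $\alpha$ is the arc containing $\sigma$. (c) *Algebraic description of $\Psi$.* Let $\mathrm{As}(Q(X))=\langle x\in X\mid x\cdot y=y\cdot(x*y)\rangle$ and let $k:X\to X$ be the unique bijection with $k(x)\,\overline{*}\,k(x)=x$. There is exactly one map $\psi:\mathrm{As}(Q(X))\times Q(X)\to X$ with $\psi(e,a)=a$, $\psi(p\cdot b,a)=\psi(p,a)\,\overline{*}\,\psi(p,b)$ and $\psi(p\cdot b^{-1},a)=\psi(p,a)\,\overline{*}^{-1}k(\psi(p,b))$. For each $Q(X)$-coloring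 $C$ of $D$ there is exactly one map $C^R$ from the regions of $D$ to $\mathrm{As}(Q(X))$ which is $e$ on the unbounded region and satisfies $C^R(R_1)\cdot C(\sigma)=C^R(R_2)$ whenever the normal vector of a semi-arc $\sigma$ points from $R_1$ to $R_2$. With the shadow coloring $C^S(\sigma)=(C^R(\rho_\sigma),C(\sigma))$, where $\rho_\sigma$ is the specified region of $\sigma$, one has $\Psi(C)=\psi\circ C^S$. -/

import Mathlib

/-!  Biquandles and their derived quandles. -/

/-- A biquandle: `underOp x y` is the operation `x` under-star `y`,
`overOp x y` is the operation `x` over-star `y`. -/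
class Biquandle (X : Type*) where
  underOp : X → X → X
  overOp : X → X → X
  under_self : ∀ x, underOp x x = overOp x x
  under_bijective : ∀ y, Function.Bijective (fun x => underOp x y)
  over_bijective : ∀ y, Function.Bijective (fun x => overOp x y)
  switch_bijective : Function.Bijective (fun p : X × X => (overOp p.2 p.1, underOp p.1 p.2))
  under_under : ∀ x y z,
    underOp (underOp x y) (underOp z y) = underOp (underOp x z) (overOp y z)
  over_over : ∀ x y z,
    overOp (overOp x y) (overOp z y) = overOp (overOp x z) (underOp y z)
  under_over : ∀ x y z,
    overOp (underOp x y) (underOp z y) = underOp (overOp x z) (overOp y z)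

namespace Biquandle

variable {X : Type*} [Biquandle X]

/-- The inverse operation: `overInv x y` is the unique `z` with `overOp z y = x`. -/
noncomputable def overInv (x y : X) : X :=
  (Equiv.ofBijective _ (over_bijective (X := X) y)).symm x

/-- The inverse operation: `underInv x y` is the unique `z` with `underOp z y = x`. -/
noncomputable def underInv (x y : X) : X :=
  (Equiv.ofBijective _ (under_bijective (X := X) y)).symm x

theorem over_overInv (x y : X) : overOp (overInv x y) y = x :=
  (Equiv.ofBijective _ (over_bijective (X := X) y)).apply_symm_apply x

theorem overInv_over (x y : X) : overInv (overOp x y) y = x :=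
  (Equiv.ofBijective _ (over_bijective (X := X) y)).symm_apply_apply x

theorem under_underInv (x y : X) : underOp (underInv x y) y = x :=
  (Equiv.ofBijective _ (under_bijective (X := X) y)).apply_symm_apply x

theorem underInv_under (x y : X) : underInv (underOp x y) y = x :=
  (Equiv.ofBijective _ (under_bijective (X := X) y)).symm_apply_apply x

theorem over_cancel {x x' : X} (y : X) (h : overOp x y = overOp x' y) : x = x' :=
  (over_bijective y).1 h

theorem over_self_bijective : Function.Bijective (fun x : X => overOp x x) := by
  constructor
  · intro x y h
    have h' : overOp x x = overOp y y := h
    have := (switch_bijective (X := X)).1 (a₁ := (x, x)) (a₂ := (y, y))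
      (by simp [under_self, h'])
    exact congrArg Prod.fst this
  · intro a
    obtain ⟨⟨x, y⟩, h⟩ := (switch_bijective (X := X)).2 (a, a)
    have h1 : overOp y x = a := congrArg Prod.fst h
    have h2 : underOp x y = a := congrArg Prod.snd h
    have h3 := under_under x y x
    rw [h1, h2] at h3
    exact ⟨x, (under_self x).symm.trans ((under_bijective a).1 h3).symm⟩

/-- The unique bijection `k` with `overOp (k x) (k x) = x`. -/
noncomputable def k : X → X :=
  (Equiv.ofBijective _ (over_self_bijective (X := X))).symm

theorem over_k_k (x : X) : overOp (k x) (k x) = x :=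
  (Equiv.ofBijective _ (over_self_bijective (X := X))).apply_symm_apply x

/-- The derived operation `x * y`, namely `underOp x y` followed by the inverse of `overOp _ y`. -/
noncomputable def star (x y : X) : X := overInv (underOp x y) y

theorem over_star (x y : X) : overOp (star x y) y = underOp x y := over_overInv _ _

theorem star_over (x y z : X) : overOp (star x y) z = star (overOp x z) (overOp y z) := by
  apply over_cancel (overOp y z)
  rw [over_star, over_over, over_star, under_over]

theorem star_star (x y z : X) : star (star x y) z = star (star x z) (star y z) := by
  apply over_cancel z
  rw [over_star, star_over (star x z), over_star, over_star]
  apply over_cancel (underOp y z)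
  rw [over_star, under_over, over_star, under_under]

theorem star_self (x : X) : star x x = x := by
  apply over_cancel x
  rw [over_star, under_self]

end Biquandle

/-- The underlying set of the derived quandle of `X` is that of `X`. -/
def DerivedQuandle (X : Type*) : Type _ := X

namespace DerivedQuandle

/-- The identity map, forgetting the derived structure. -/
def toBase {X : Type*} (a : DerivedQuandle X) : X := a

/-- The identity map to the derived quandle. -/
def ofBase {X : Type*} (a : X) : DerivedQuandle X := a

/-- The derived quandle.  In Mathlib a quandle acts on itself from the left; the right
operation `a * b` is written `Shelf.act b a`. -/
noncomputable instance {X : Type*} [Biquandle X] : Quandle (DerivedQuandle X) where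
  act y x := ofBase (Biquandle.star (toBase x) (toBase y))
  self_distrib := fun {x y z} => Biquandle.star_star (X := X) z y x
  invAct y x := ofBase (Biquandle.underInv (Biquandle.overOp (toBase x) (toBase y)) (toBase y))
  left_inv y x := (congrArg (fun t : X => Biquandle.underInv t y)
    (Biquandle.over_star (X := X) x y)).trans (Biquandle.underInv_under (X := X) x y)
  right_inv y x := (congrArg (fun t : X => Biquandle.overInv t y)
    (Biquandle.under_underInv (X := X) (Biquandle.overOp (X := X) x y) y)).trans
      (Biquandle.overInv_over (X := X) x y)
  fix := fun {x} => Biquandle.star_self (X := X) x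

end DerivedQuandle

/-- The associated group of a quandle: generated by the elements of `Q` with the relations
`x * y = y * (x ∗ y)`, where `x ∗ y` is the right quandle operation. -/
abbrev AssocGroup (Q : Type*) [Quandle Q] : Type _ :=
  PresentedGroup {w : FreeGroup Q | ∃ x y : Q,
    w = (FreeGroup.of x * FreeGroup.of y) *
      (FreeGroup.of y * FreeGroup.of (Shelf.act y x))⁻¹}

/-- The generator of the associated group given by an element of the quandle. -/
def AssocGroup.of {Q : Type*} [Quandle Q] (a : Q) : AssocGroup Q := PresentedGroup.of a

/-- The recursive equations for the map `ψ` from pairs (group element, quandle element) to `X`. -/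
structure IsPsi {X : Type*} [Biquandle X]
    (ψ : AssocGroup (DerivedQuandle X) → DerivedQuandle X → X) : Prop where
  one : ∀ a, ψ 1 a = a.toBase
  mul : ∀ p a b, ψ (p * AssocGroup.of b) a = Biquandle.overOp (ψ p a) (ψ p b)
  mul_inv : ∀ p a b,
    ψ (p * (AssocGroup.of b)⁻¹) a = Biquandle.overInv (ψ p a) (Biquandle.k (ψ p b))

/-!  Oriented link diagrams.

A diagram is drawn in the plane in general position with respect to the height function and cut
by horizontal lines into strips, each containing one maximum, one minimum or one crossing and
otherwise only vertical strings.  Every oriented link diagram is planar isotopic to such a one.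
A horizontal line meets the diagram in a finite row of strings, recorded from left to right by
their orientations: `true` is downward, `false` is upward. -/

/-- One strip, with `l` and `r` the orientations of the vertical strings to the left and right.
* `birth l r d`: a local maximum, whose left leg is downward iff `d = true`;
* `death l r d`: a local minimum, whose left leg is downward iff `d = true`;
* `cross l r a b o`: a crossing of the string from top left to bottom right (orientation `a`)
  with the string from top right to bottom left (orientation `b`); the former is the over string
  iff `o = true`. -/
inductive Slice
  | birth (l r : List Bool) (d : Bool)
  | death (l r : List Bool) (d : Bool)
  | cross (l r : List Bool) (a b o : Bool)

namespace Slice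

/-- The row of strings on the upper boundary of the strip. -/
def top : Slice → List Bool
  | birth l r _ => l ++ r
  | death l r d => l ++ d :: (!d) :: r
  | cross l r a b _ => l ++ a :: b :: r

/-- The row of strings on the lower boundary of the strip. -/
def bot : Slice → List Bool
  | birth l r d => l ++ d :: (!d) :: r
  | death l r _ => l ++ r
  | cross l r a b _ => l ++ b :: a :: r

/-- Boundary points of a strip that are ends of one string in it not taking part in a crossing.
Here `Sum.inl i` is the `i`-th point of the upper boundary and `Sum.inr i` that of the lower
boundary, counted from `0`. -/
inductive Joins : Slice → ℕ ⊕ ℕ → ℕ ⊕ ℕ → Prop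
  | birth_left (l r d i) : i < l.length → Joins (birth l r d) (.inl i) (.inr i)
  | birth_right (l r d i) : l.length ≤ i → Joins (birth l r d) (.inl i) (.inr (i + 2))
  | birth_arch (l r d) : Joins (birth l r d) (.inr l.length) (.inr (l.length + 1))
  | death_left (l r d i) : i < l.length → Joins (death l r d) (.inl i) (.inr i)
  | death_right (l r d i) : l.length ≤ i → Joins (death l r d) (.inl (i + 2)) (.inr i)
  | death_arch (l r d) : Joins (death l r d) (.inl l.length) (.inl (l.length + 1))
  | cross_left (l r a b o i) : i < l.length → Joins (cross l r a b o) (.inl i) (.inr i)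
  | cross_right (l r a b o i) : l.length + 2 ≤ i → Joins (cross l r a b o) (.inl i) (.inr i)

/-- The two ends of the over string of a crossing. -/
inductive OverJoins : Slice → ℕ ⊕ ℕ → ℕ ⊕ ℕ → Prop
  | left (l r a b) : OverJoins (cross l r a b true) (.inl l.length) (.inr (l.length + 1))
  | right (l r a b) : OverJoins (cross l r a b false) (.inl (l.length + 1)) (.inr l.length)

/-- Gaps on the boundary of a strip that bound the same region of the strip.  The `i`-th gap is
the one with exactly `i` strings to its left. -/
inductive JoinsGaps : Slice → ℕ ⊕ ℕ → ℕ ⊕ ℕ → Prop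
  | birth_left (l r d i) : i ≤ l.length → JoinsGaps (birth l r d) (.inl i) (.inr i)
  | birth_right (l r d i) : l.length ≤ i → JoinsGaps (birth l r d) (.inl i) (.inr (i + 2))
  | death_left (l r d i) : i ≤ l.length → JoinsGaps (death l r d) (.inl i) (.inr i)
  | death_right (l r d i) : l.length ≤ i → JoinsGaps (death l r d) (.inl (i + 2)) (.inr i)
  | cross_left (l r a b o i) : i ≤ l.length → JoinsGaps (cross l r a b o) (.inl i) (.inr i)
  | cross_right (l r a b o i) : l.length + 2 ≤ i →
      JoinsGaps (cross l r a b o) (.inl i) (.inr i)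

end Slice

/-- The strips `L`, stacked from top to bottom, match along their boundaries, starting with the
row `u` and ending with the row `v`. -/
def IsTangle : List Bool → List Slice → List Bool → Prop
  | u, [], v => u = v
  | u, s :: L, v => s.top = u ∧ IsTangle s.bot L v

/-- A diagram of an oriented link. -/
structure LinkDiagram where
  slices : List Slice
  isTangle : IsTangle [] slices []

/-- The four ends at a crossing: `i` and `k` are the two halves of the under string, `j` and `l`
those of the over string, where `i` and `j` are the halves that bound the specified region of the
crossing, the one from which both normal vectors point away. -/
structure Quad (α : Type*) where
  i : α
  j : α
  k : α
  l : α

/-- The four ends at a crossing with orientations `a`, `b` and crossing information `o` as for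
`Slice.cross`.  Normal vectors point to the left of the direction of travel (a downward string has
its normal vector pointing to the right of the page), so the specified region of the crossing is
the one lying on the right-hand side of both strings. -/
def Quad.ofEnds {α : Type*} (a b o : Bool) (tl tr bl br : α) : Quad α :=
  let nearA := if b then tl else br
  let farA := if b then br else tl
  let nearB := if a then bl else tr
  let farB := if a then tr else bl
  if o then ⟨nearB, nearA, farB, farA⟩ else ⟨nearA, nearB, farA, farB⟩

/-- The biquandle coloring condition at one crossing. -/
def Quad.IsBiquandleColored {X : Type*} [Biquandle X] (q : Quad X) : Prop :=
  Biquandle.underOp q.i q.j = q.k ∧ Biquandle.overOp q.j q.i = q.l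

namespace LinkDiagram

variable (D : LinkDiagram)

/-- The row of strings met by the `j`-th horizontal line, which is the upper boundary of the
`j`-th strip. -/
def row (j : ℕ) : List Bool :=
  match D.slices[j]? with
  | some s => s.top
  | none => []

/-- The intersection points of the diagram with the horizontal lines: `(j, i)` is the `i`-th
point on the `j`-th line. -/
def Point : Type := {p : ℕ × ℕ // p.2 < (D.row p.1).length}

/-- The gaps between the strings on the horizontal lines. -/
def Gap : Type := {g : ℕ × ℕ // g.1 ≤ D.slices.length ∧ g.2 ≤ (D.row g.1).length}

/-- Position in the diagram of a place on the boundary of the `j`-th strip. -/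
def place (j : ℕ) : ℕ ⊕ ℕ → ℕ × ℕ
  | .inl i => (j, i)
  | .inr i => (j + 1, i)

/-- Two points connected within one strip, away from crossings. -/
def Joined (p q : D.Point) : Prop :=
  ∃ j s e f, D.slices[j]? = some s ∧ s.Joins e f ∧ p.1 = place j e ∧ q.1 = place j f

/-- Two points connected through the over string of a crossing. -/
def OverJoined (p q : D.Point) : Prop :=
  ∃ j s e f, D.slices[j]? = some s ∧ s.OverJoins e f ∧ p.1 = place j e ∧ q.1 = place j f

/-- Two gaps connected within one strip, in the complement of the diagram. -/
def GapJoined (g h : D.Gap) : Prop :=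
  ∃ j s e f, D.slices[j]? = some s ∧ s.JoinsGaps e f ∧ g.1 = place j e ∧ h.1 = place j f

/-- The set of semi-arcs. -/
def SemiArc : Type := Quot D.Joined

/-- The set of arcs. -/
def Arc : Type := Quot fun p q => D.Joined p q ∨ D.OverJoined p q

/-- The set of regions, the connected components of the complement of the diagram. -/
def Region : Type := Quot D.GapJoined

/-- The semi-arc through a point. -/
def semiArc (p : D.Point) : D.SemiArc := Quot.mk _ p

/-- The natural surjection from semi-arcs to arcs. -/
def proj : D.SemiArc → D.Arc := Quot.map id fun _ _ h => Or.inl h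

/-- The arc through a point. -/
def arc (p : D.Point) : D.Arc := D.proj (D.semiArc p)

/-- The unbounded region. -/
def unbounded : D.Region := Quot.mk _ ⟨(0, 0), Nat.zero_le _, Nat.zero_le _⟩

theorem level_le {j i : ℕ} (h : i < (D.row j).length) : j ≤ D.slices.length := by
  by_contra hj
  have : D.slices[j]? = none := List.getElem?_eq_none (by omega)
  simp [row, this] at h

/-- The region on the left side (on the page) of a point. -/
def leftRegion (p : D.Point) : D.Region :=
  Quot.mk _ ⟨p.1, D.level_le p.2, p.2.le⟩

/-- The region on the right side (on the page) of a point. -/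
def rightRegion (p : D.Point) : D.Region :=
  Quot.mk _ ⟨(p.1.1, p.1.2 + 1), D.level_le p.2, p.2⟩

/-- The orientation of the string through a point. -/
def down (p : D.Point) : Bool := (D.row p.1.1)[p.1.2]'p.2

/-- The specified region at a point of a semi-arc: the one from which its normal vector points. -/
def specified (p : D.Point) : D.Region :=
  if D.down p then D.leftRegion p else D.rightRegion p

/-- The region to which the normal vector at a point of a semi-arc points. -/
def opposite (p : D.Point) : D.Region :=
  if D.down p then D.rightRegion p else D.leftRegion p

/-- The four points of the diagram around some crossing. -/
def IsCrossing (q : Quad D.Point) : Prop :=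
  ∃ (j : ℕ) (l r : List Bool) (a b o : Bool) (tl tr bl br : D.Point),
    D.slices[j]? = some (.cross l r a b o) ∧
    tl.1 = (j, l.length) ∧ tr.1 = (j, l.length + 1) ∧
    bl.1 = (j + 1, l.length) ∧ br.1 = (j + 1, l.length + 1) ∧
    q = Quad.ofEnds a b o tl tr bl br

/-- Quandle colorings of a diagram. -/
structure QuandleColoring (Q : Type*) [Quandle Q] where
  toFun : D.Arc → Q
  crossing : ∀ q, D.IsCrossing q →
    Shelf.act (toFun (D.arc q.j)) (toFun (D.arc q.i)) = toFun (D.arc q.k)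

/-- Biquandle colorings of a diagram. -/
structure BiquandleColoring (X : Type*) [Biquandle X] where
  toFun : D.SemiArc → X
  crossing : ∀ q, D.IsCrossing q →
    Quad.IsBiquandleColored ⟨toFun (D.semiArc q.i), toFun (D.semiArc q.j),
      toFun (D.semiArc q.k), toFun (D.semiArc q.l)⟩

/-- Given values at the points, the row of orientations and values along the `j`-th line. -/
def coloredRow {X : Type*} (c : D.Point → X) (j : ℕ) : List (Bool × X) :=
  List.ofFn fun i : Fin (D.row j).length => ((D.row j)[i], c ⟨(j, i), i.2⟩)

variable {D}

/-- The row of orientations and colors along the `j`-th line. -/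
def QuandleColoring.row {Q : Type*} [Quandle Q] (C : D.QuandleColoring Q) (j : ℕ) :
    List (Bool × Q) :=
  D.coloredRow (fun p => C.toFun (D.arc p)) j

/-- The row of orientations and colors along the `j`-th line. -/
def BiquandleColoring.row {X : Type*} [Biquandle X] (C : D.BiquandleColoring X) (j : ℕ) :
    List (Bool × X) :=
  D.coloredRow (fun p => C.toFun (D.semiArc p)) j

/-- `R` is the region coloring with respect to the quandle coloring `C`. -/
structure IsRegionColoring {Q : Type*} [Quandle Q] (C : D.QuandleColoring Q)
    (R : D.Region → AssocGroup Q) : Prop where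
  unbounded : R D.unbounded = 1
  cross : ∀ p : D.Point,
    R (D.specified p) * AssocGroup.of (C.toFun (D.arc p)) = R (D.opposite p)

end LinkDiagram

/-!  The doubled diagram and the disjoint union with the reversed mirror image. -/

theorem IsTangle.append : ∀ {u v w : List Bool} {L M : List Slice},
    IsTangle u L v → IsTangle v M w → IsTangle u (L ++ M) w
  | _, _, _, [], _, h, h' => by
    have h : _ = _ := h
    subst h
    exact h'
  | _, _, _, _ :: _, _, h, h' => ⟨h.1, IsTangle.append h.2 h'⟩

/-- The row of the doubled diagram.  Each string is replaced by itself and its parallel copy,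
pushed in the normal direction and with the opposite orientation: a downward string has its copy
on its right, an upward one on its left, so that each pair reads downward, upward. -/
def doubleRow (u : List Bool) : List Bool := u.flatMap fun _ => [true, false]

/-- For each string of the doubled row, whether it belongs to the original (front) diagram. -/
def frontTags (u : List Bool) : List Bool := u.flatMap fun d => [d, !d]

/-- Crossing information in the doubled diagram, for the strings from top left and from top right,
`f` and `g` telling whether they belong to the original diagram: the original is in front of the
copy, originals cross as before (`o`) and copies cross in the opposite way. -/
def doubleOver (o f g : Bool) : Bool :=
  if f then (if g then o else true) else (if g then false else !o)

/-- The doubled diagram of a strip. -/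
def Slice.double : Slice → List Slice
  | birth l r _ =>
    [birth (doubleRow l) (doubleRow r) true,
     birth (doubleRow l ++ [true]) (false :: doubleRow r) false]
  | death l r _ =>
    [death (doubleRow l ++ [true]) (false :: doubleRow r) false,
     death (doubleRow l) (doubleRow r) true]
  | cross l r a b o =>
    [cross (doubleRow l ++ [true]) (false :: doubleRow r) false true (doubleOver o (!a) b),
     cross (doubleRow l) (false :: false :: doubleRow r) true true (doubleOver o a b),
     cross (doubleRow l ++ [true, true]) (doubleRow r) false false (doubleOver o (!a) (!b)),
     cross (doubleRow l ++ [true]) (false :: doubleRow r) true false (doubleOver o a (!b))]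

theorem Slice.double_isTangle (s : Slice) :
    IsTangle (doubleRow s.top) s.double (doubleRow s.bot) := by
  cases s <;> simp [IsTangle, Slice.double, Slice.top, Slice.bot, doubleRow]

theorem IsTangle.double : ∀ {u v : List Bool} {L : List Slice}, IsTangle u L v →
    IsTangle (doubleRow u) (L.flatMap Slice.double) (doubleRow v)
  | _, _, [], h => congrArg doubleRow h
  | _, _, s :: _, h => by
    rw [List.flatMap_cons]
    exact h.1 ▸ IsTangle.append s.double_isTangle (IsTangle.double h.2)

/-- The row of the mirror image in a vertical line, with the opposite orientation. -/
def mirrorRow (u : List Bool) : List Bool := (u.map not).reverse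

/-- The mirror image of a strip in a vertical line with the opposite orientation, to the right of
the vertical strings `u`. -/
def Slice.mirror (u : List Bool) : Slice → Slice
  | birth l r d => birth (u ++ mirrorRow r) (mirrorRow l) d
  | death l r d => death (u ++ mirrorRow r) (mirrorRow l) d
  | cross l r a b o => cross (u ++ mirrorRow r) (mirrorRow l) (!b) (!a) (!o)

/-- A strip, to the left of the vertical strings `u`. -/
def Slice.addRight (u : List Bool) : Slice → Slice
  | birth l r d => birth l (r ++ u) d
  | death l r d => death l (r ++ u) d
  | cross l r a b o => cross l (r ++ u) a b o

/-- A strip next to its mirror image with the opposite orientation; the strip is passed first. -/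
def Slice.besideMirror (s : Slice) : List Slice :=
  [s.addRight (mirrorRow s.top), s.mirror s.bot]

theorem Slice.besideMirror_isTangle (s : Slice) :
    IsTangle (s.top ++ mirrorRow s.top) s.besideMirror (s.bot ++ mirrorRow s.bot) := by
  cases s <;> simp [IsTangle, besideMirror, addRight, mirror, top, bot, mirrorRow]

theorem IsTangle.besideMirror : ∀ {u v : List Bool} {L : List Slice}, IsTangle u L v →
    IsTangle (u ++ mirrorRow u) (L.flatMap Slice.besideMirror) (v ++ mirrorRow v)
  | _, _, [], h => congrArg (fun u => u ++ mirrorRow u) h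
  | _, _, s :: _, h => by
    rw [List.flatMap_cons]
    exact h.1 ▸ IsTangle.append s.besideMirror_isTangle (IsTangle.besideMirror h.2)

/-- A string with a color, `front` telling whether it belongs to the front part. -/
structure Strand (X : Type*) where
  front : Bool
  down : Bool
  color : X

/-- `Slide d x u u' y`: a string with orientation `d` and color `x` at the top moves to the right,
passing under all strings of the row `u` one after the other; at the bottom the row has become
`u'` and the moving string, now at the right end, has the color `y`. -/
inductive Slide {X : Type*} [Biquandle X] (d : Bool) :
    X → List (Strand X) → List (Strand X) → X → Prop
  | nil (x) : Slide d x [] [] x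
  | cons (x x' y : X) (t : Strand X) (c : X) (u u' : List (Strand X)) :
      (Quad.ofEnds d t.down false x t.color c x').IsBiquandleColored →
      Slide d x' u u' y → Slide d x (t :: u) (⟨t.front, t.down, c⟩ :: u') y

/-- `PullAway u F B`: in the colored row `u` the leftmost back string is moved to the right end,
then the second back string to the left of the first, and so on, always passing under the other
strings; the result is the row `F` of front strings followed by the row `B` of back strings. -/
inductive PullAway {X : Type*} [Biquandle X] :
    List (Strand X) → List (Bool × X) → List (Bool × X) → Prop
  | nil : PullAway [] [] []
  | front (d : Bool) (x : X) (u : List (Strand X)) (F B : List (Bool × X)) :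
      PullAway u F B → PullAway (⟨true, d, x⟩ :: u) ((d, x) :: F) B
  | back (d : Bool) (x y : X) (u u' : List (Strand X)) (F B : List (Bool × X)) :
      Slide d x u u' y → PullAway u' F B → PullAway (⟨false, d, x⟩ :: u) F (B ++ [(d, y)])

namespace LinkDiagram

/-- The doubled diagram `W(D)`. -/
def double (D : LinkDiagram) : LinkDiagram where
  slices := D.slices.flatMap Slice.double
  isTangle := D.isTangle.double

/-- The line of `W(D)` that corresponds to the `j`-th line of `D`. -/
def doubleLevel (D : LinkDiagram) (j : ℕ) : ℕ :=
  ((D.slices.take j).flatMap Slice.double).length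

/-- The disjoint union of `D` and, on its right, its horizontal mirror image with the opposite
orientation.  The `j`-th line of `D` has become the `2 * j`-th line. -/
def besideMirror (D : LinkDiagram) : LinkDiagram where
  slices := D.slices.flatMap Slice.besideMirror
  isTangle := D.isTangle.besideMirror

variable {D : LinkDiagram} {X : Type*} [Biquandle X]

/-- Doubling: `C₁` is a biquandle coloring of the doubled diagram in which, away from the
crossings of `D`, both strings of each parallel pair receive the color of the quandle
coloring `C`. -/
def IsDoubled (C : D.QuandleColoring (DerivedQuandle X)) (C₁ : D.double.BiquandleColoring X) :
    Prop :=
  ∀ j, C₁.row (D.doubleLevel j) =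
    (C.row j).flatMap fun s => [(true, s.2.toBase), (false, s.2.toBase)]

/-- Pulling away: on each horizontal line of `D`, the copies of the strings are pulled away from
the doubled row, with the colors transported by the coloring condition at each new crossing, and
`C₂` is a coloring of the disjoint union having the resulting colors on that line. -/
def IsPulledAway (C₁ : D.double.BiquandleColoring X) (C₂ : D.besideMirror.BiquandleColoring X) :
    Prop :=
  ∀ j, ∃ F B : List (Bool × X),
    PullAway (List.zipWith (fun f s => (⟨f, s.1, s.2⟩ : Strand X))
      (frontTags (D.row j)) (C₁.row (D.doubleLevel j))) F B ∧
    C₂.row (2 * j) = F ++ B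

/-- Restricting: `C` is the restriction of `C₂` to the left part `D` of the disjoint union. -/
def IsRestriction (C₂ : D.besideMirror.BiquandleColoring X) (C : D.BiquandleColoring X) : Prop :=
  ∀ j, C.row j = (C₂.row (2 * j)).take (D.row j).length

/-- `D.Path γ R`: an arc from the unbounded region to the region `R` that crosses the diagram
transversely at the points listed in `γ`, in the order from the end of the arc to its start; the
entry is marked `true` if the arc crosses in the direction of the normal vector. -/
inductive Path (D : LinkDiagram) : List (Bool × D.Point) → D.Region → Prop
  | start : Path D [] D.unbounded
  | along (γ p) : Path D γ (D.specified p) → Path D ((true, p) :: γ) (D.opposite p)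
  | against (γ p) : Path D γ (D.opposite p) → Path D ((false, p) :: γ) (D.specified p)

/-- `PushOut C γ y a`: a semi-arc of color `y`, reached by the arc `γ` from its specified region,
is pushed out along `γ` over all strings that `γ` crosses, and the head of the pushed-out part has
color `a`.  Draw `γ` from left to right: the semi-arc is then directed downward and the crossed
strings are downward or upward as `γ` crosses them along or against the normal vector.  The upper
boundary of the pushed-out part goes from top right, over the string `p`, to bottom left, while
`p` enters from top left with its original color and goes on below with some color `t`. -/
inductive PushOut (C : D.BiquandleColoring X) : List (Bool × D.Point) → X → X → Prop
  | nil (y) : PushOut C [] y y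
  | cons (e : Bool) (p : D.Point) (γ : List (Bool × D.Point)) (y z t a : X) :
      (Quad.ofEnds e true false (C.toFun (D.semiArc p)) y z t).IsBiquandleColored →
      PushOut C γ z a → PushOut C ((e, p) :: γ) y a

end LinkDiagram

/-!
Every `y` in a biquandle gives an automorphism `x ↦ overOp x y` of the derived quandle. The
associated group acts from the right on the automorphisms of the derived quandle, the generator `b`
sending `f` to `overOp · (f b) ∘ f`. If `state p` is the image of the identity under `p`, then
`ψ (p, a) = state p a`, so that the quandle and the biquandle coloring differ in each region by the
automorphism `state p`, where `p` is the label of the region.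

Labels of regions with values in a group are products of increments along a horizontal line. They
are well defined because the increments around a crossing are balanced. This applies to the colors
of a quandle coloring, and also to the inverses of the automorphisms `overOp · y` for the colors
`y` of a biquandle coloring. The second labelling describes pushing out to the unbounded region
and is inverse to the first one under `state`.

When the copies are pulled away from a doubled row, a copy string passing under a strand acts on it
by the automorphism of its color, hence by `state` of the label of the region.
-/

/-! ### The action of the associated group of the derived quandle -/

namespace Biquandle

variable {X : Type*} [Biquandle X]

theorem k_over_self (x : X) : k (overOp x x) = x :=
  over_self_bijective.1 (over_k_k _)

theorem overInv_k (x : X) : overInv x (k x) = k x :=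
  over_cancel (k x) (by rw [over_overInv, over_k_k])

variable (X) in
/-- The group of automorphisms of the derived quandle. -/
def starAut : Subgroup (Equiv.Perm X) where
  carrier := {f | ∀ x y, f (star x y) = star (f x) (f y)}
  mul_mem' hf hg x y := by
    rw [Equiv.Perm.mul_apply, hg x y, hf]
    rfl
  one_mem' _ _ := rfl
  inv_mem' {f} hf x y := by
    rw [Equiv.Perm.inv_eq_iff_eq, hf]
    simp

theorem smul_star (f : starAut X) (x y : X) : f • star x y = star (f • x) (f • y) :=
  f.2 x y

/-- The automorphism `x ↦ overOp x y` of the derived quandle. -/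
noncomputable def overAut (y : X) : starAut X :=
  ⟨Equiv.ofBijective _ (over_bijective y), fun x z => star_over x z y⟩

@[simp]
theorem overAut_smul (x y : X) : overAut y • x = overOp x y := rfl

@[simp]
theorem overAut_inv_smul (x y : X) : (overAut y)⁻¹ • x = overInv x y := rfl

theorem starAut_ext {f g : starAut X} (h : ∀ x : X, f • x = g • x) : f = g :=
  Subtype.ext (Equiv.ext h)

theorem overAut_mul (x y : X) :
    overAut (overOp y x) * overAut x = overAut (underOp x y) * overAut y :=
  starAut_ext fun z => by
    simpa [mul_smul] using over_over z x y

end Biquandle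

namespace AssocGroup

variable {Q : Type*} [Quandle Q]

theorem of_mul_of (x y : Q) : of x * of y = of y * of (Shelf.act y x) :=
  mul_inv_eq_one.1 <| PresentedGroup.one_of_mem (rels := {w : FreeGroup Q | ∃ x y : Q,
    w = (FreeGroup.of x * FreeGroup.of y) *
      (FreeGroup.of y * FreeGroup.of (Shelf.act y x))⁻¹}) ⟨x, y, rfl⟩

theorem closure_range_of : Subgroup.closure (Set.range (of (Q := Q))) = ⊤ :=
  PresentedGroup.closure_range_of _

end AssocGroup

namespace Biquandle

open MulOpposite

variable {X : Type*} [Biquandle X]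

/-- The right action of the generator `b` of the associated group on the automorphisms of the
derived quandle. It changes the automorphism `f` by the string colored `f • b`. -/
noncomputable def shift (b : X) : Equiv.Perm (starAut X) where
  toFun f := overAut (f • b) * f
  invFun f := (overAut (k (f • b)))⁻¹ * f
  left_inv f := by simp [mul_smul, k_over_self]
  right_inv f := by simp [mul_smul, overInv_k]

theorem shift_comm (x y : X) (f : starAut X) :
    shift y (shift x f) = shift (star x y) (shift y f) := by
  change overAut ((overAut (f • x) * f) • y) * (overAut (f • x) * f) =
    overAut ((overAut (f • y) * f) • star x y) * (overAut (f • y) * f)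
  rw [mul_smul, mul_smul, overAut_smul, overAut_smul, ← mul_assoc, ← mul_assoc, smul_star,
    over_star, overAut_mul]

/-- The right action of the associated group on the automorphisms of the derived quandle. -/
noncomputable def shiftHom :
    AssocGroup (DerivedQuandle X) →* (Equiv.Perm (starAut X))ᵐᵒᵖ :=
  PresentedGroup.toGroup (f := fun b => op (shift b.toBase)) (by
    rintro _ ⟨x, y, rfl⟩
    rw [map_mul, map_inv, map_mul, map_mul, mul_inv_eq_one]
    simp only [FreeGroup.lift_apply_of]
    exact unop_injective (Equiv.ext (shift_comm x.toBase y.toBase)))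

theorem shiftHom_of (b : DerivedQuandle X) : shiftHom (.of b) = op (shift b.toBase) :=
  PresentedGroup.toGroup.of _

/-- The automorphism to which an element of the associated group moves the identity; it carries
the quandle colors to the biquandle colors in a region labelled by this element. -/
noncomputable def state (p : AssocGroup (DerivedQuandle X)) : starAut X :=
  (shiftHom p).unop 1

theorem state_one : state (1 : AssocGroup (DerivedQuandle X)) = 1 := by
  rw [state, map_one shiftHom]
  rfl

theorem state_mul_of (p : AssocGroup (DerivedQuandle X)) (b : DerivedQuandle X) :
    state (p * .of b) = shift b.toBase (state p) := by
  rw [state, map_mul, shiftHom_of]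
  rfl

theorem state_mul_of_inv (p : AssocGroup (DerivedQuandle X)) (b : DerivedQuandle X) :
    state (p * (AssocGroup.of b)⁻¹) = (shift b.toBase).symm (state p) := by
  rw [state, map_mul, map_inv, shiftHom_of]
  rfl

/-- The map `ψ` of part (c): the element `p` acts on `X` through its automorphism `state p`. -/
noncomputable def psi (p : AssocGroup (DerivedQuandle X)) (a : DerivedQuandle X) : X :=
  state p • a.toBase

theorem state_mul_of_eq (p : AssocGroup (DerivedQuandle X)) (b : DerivedQuandle X) :
    state (p * .of b) = overAut (psi p b) * state p :=
  state_mul_of p b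

theorem state_mul_of_inv_eq (p : AssocGroup (DerivedQuandle X)) (b : DerivedQuandle X) :
    state (p * (AssocGroup.of b)⁻¹) = (overAut (k (psi p b)))⁻¹ * state p :=
  state_mul_of_inv p b

theorem isPsi_psi : IsPsi (psi (X := X)) where
  one a := by rw [psi, state_one, one_smul]
  mul p a b := by
    rw [psi, state_mul_of_eq, mul_smul]
    rfl
  mul_inv p a b := by
    rw [psi, state_mul_of_inv_eq, mul_smul]
    rfl

theorem psi_mul_of_inv_self (p : AssocGroup (DerivedQuandle X)) (b : DerivedQuandle X) :
    psi (p * (AssocGroup.of b)⁻¹) b = k (psi p b) := by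
  rw [isPsi_psi.mul_inv, overInv_k]

end Biquandle

open Biquandle

theorem IsPsi.eq {X : Type*} [Biquandle X]
    {ψ ψ' : AssocGroup (DerivedQuandle X) → DerivedQuandle X → X}
    (h : IsPsi ψ) (h' : IsPsi ψ') : ψ = ψ' := by
  funext p
  have hp : p ∈ Subgroup.closure (Set.range (AssocGroup.of (Q := DerivedQuandle X))) :=
    AssocGroup.closure_range_of (Q := DerivedQuandle X) ▸ Subgroup.mem_top p
  induction hp using Subgroup.closure_induction_right with
  | one => exact funext fun a => (h.one a).trans (h'.one a).symm
  | mul_right p _ _ hb ih =>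
    obtain ⟨b, rfl⟩ := hb
    exact funext fun a => by rw [h.mul, h'.mul, ih]
  | mul_inv_cancel p _ _ hb ih =>
    obtain ⟨b, rfl⟩ := hb
    exact funext fun a => by rw [h.mul_inv, h'.mul_inv, ih]

namespace Quad

/-- The quadruple of the images under `f`. -/
def map {α β : Type*} (f : α → β) (q : Quad α) : Quad β :=
  ⟨f q.i, f q.j, f q.k, f q.l⟩

theorem map_ofEnds {α β : Type*} (f : α → β) (a b o : Bool) (x y z w : α) :
    (ofEnds a b o x y z w).map f = ofEnds a b o (f x) (f y) (f z) (f w) := by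
  cases a <;> cases b <;> cases o <;> rfl

/-- The quandle coloring condition at one crossing, including that the over string keeps its
color. -/
def IsQuandleColored {Q : Type*} [Quandle Q] (q : Quad Q) : Prop :=
  Shelf.act q.j q.i = q.k ∧ q.j = q.l

/-- The condition on group elements at the four ends of a crossing which makes them the
increments of a function on the four regions around the crossing. -/
def IsBalanced {G : Type*} [Group G] (q : Quad G) : Prop :=
  q.i * q.l = q.j * q.k

section Biquandle

variable {X : Type*} [Biquandle X] {q q' : Quad X}

theorem IsBiquandleColored.isBalanced (h : q.IsBiquandleColored) :
    (q.map fun x => (overAut x)⁻¹).IsBalanced := by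
  simp only [IsBalanced, map, ← mul_inv_rev, inv_inj]
  rw [← h.1, ← h.2, overAut_mul]

theorem IsQuandleColored.isBalanced {Q : Type*} [Quandle Q] {q : Quad Q}
    (h : q.IsQuandleColored) : (q.map AssocGroup.of).IsBalanced := by
  simp only [IsBalanced, map]
  rw [← h.1, ← h.2, AssocGroup.of_mul_of]

theorem IsBiquandleColored.isQuandleColored (h : q.IsBiquandleColored) (t : starAut X) :
    Quad.IsQuandleColored (Q := DerivedQuandle X) ⟨.ofBase (t • q.i), .ofBase (t • q.j),
      .ofBase ((t * (overAut q.j)⁻¹) • q.k), .ofBase ((t * (overAut q.i)⁻¹) • q.l)⟩ := by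
  constructor
  · change star (t • q.i) (t • q.j) = (t * (overAut q.j)⁻¹) • q.k
    rw [mul_smul, ← smul_star, ← h.1]
    rfl
  · change t • q.j = (t * (overAut q.i)⁻¹) • q.l
    rw [mul_smul, ← h.2, overAut_inv_smul, overInv_over]

theorem IsQuandleColored.isBiquandleColored {q : Quad (DerivedQuandle X)}
    (h : q.IsQuandleColored) (p : AssocGroup (DerivedQuandle X)) :
    Quad.IsBiquandleColored ⟨psi p q.i, psi p q.j, psi (p * .of q.j) q.k,
      psi (p * .of q.i) q.l⟩ := by
  constructor
  · change underOp (psi p q.i) (psi p q.j) = _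
    rw [← h.1, isPsi_psi.mul, ← over_star]
    exact congrArg (overOp · _) (smul_star _ _ _).symm
  · change overOp (psi p q.j) (psi p q.i) = _
    exact h.2 ▸ (isPsi_psi.mul p q.j q.i).symm

theorem IsBiquandleColored.eq_of_ij (h : q.IsBiquandleColored) (h' : q'.IsBiquandleColored)
    (hi : q.i = q'.i) (hj : q.j = q'.j) : q = q' := by
  obtain ⟨i, j, k, l⟩ := q
  obtain ⟨i', j', k', l'⟩ := q'
  simp only [IsBiquandleColored] at *
  grind

theorem IsBiquandleColored.eq_of_kl (h : q.IsBiquandleColored) (h' : q'.IsBiquandleColored)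
    (hk : q.k = q'.k) (hl : q.l = q'.l) : q = q' := by
  have e : (q.i, q.j) = (q'.i, q'.j) := switch_bijective.1 <| Prod.ext
    (h.2.trans (hl.trans h'.2.symm)) (h.1.trans (hk.trans h'.1.symm))
  exact h.eq_of_ij h' (congrArg Prod.fst e) (congrArg Prod.snd e)

theorem IsBiquandleColored.eq_of_il (h : q.IsBiquandleColored) (h' : q'.IsBiquandleColored)
    (hi : q.i = q'.i) (hl : q.l = q'.l) : q = q' :=
  h.eq_of_ij h' hi (over_cancel q.i (by rw [h.2, hl, hi, h'.2]))

theorem IsBiquandleColored.eq_of_jk (h : q.IsBiquandleColored) (h' : q'.IsBiquandleColored)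
    (hj : q.j = q'.j) (hk : q.k = q'.k) : q = q' :=
  h.eq_of_ij h' ((under_bijective q.j).1 ((h.1.trans hk).trans (hj ▸ h'.1.symm))) hj

theorem bottom_unique {a b o : Bool} {x y z w z' w' : X}
    (h : (ofEnds a b o x y z w).IsBiquandleColored)
    (h' : (ofEnds a b o x y z' w').IsBiquandleColored) : z = z' ∧ w = w' := by
  suffices ofEnds a b o x y z w = ofEnds a b o x y z' w' by
    cases a <;> cases b <;> cases o <;> cases this <;> exact ⟨rfl, rfl⟩
  cases a <;> cases b <;> cases o
  all_goals first
    | exact h.eq_of_ij h' rfl rfl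
    | exact h.eq_of_kl h' rfl rfl
    | exact h.eq_of_il h' rfl rfl
    | exact h.eq_of_jk h' rfl rfl

end Biquandle

end Quad

/-! ### Colorings in terms of the rows of a diagram -/

theorem eq_of_map_fst_eq_of_map_snd_eq {α β : Type*} {M N : List (α × β)}
    (h₁ : M.map Prod.fst = N.map Prod.fst) (h₂ : M.map Prod.snd = N.map Prod.snd) : M = N := by
  simpa [← List.unzip_fst, ← List.unzip_snd, List.zip_unzip] using congrArg₂ List.zip h₁ h₂

namespace Slice

/-- The orientations of the vertical strings to the left of the crossing, maximum or minimum. -/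
def left : Slice → List Bool
  | birth l _ _ | death l _ _ | cross l _ _ _ _ => l

/-- The orientations of the vertical strings to the right of the crossing, maximum or minimum. -/
def right : Slice → List Bool
  | birth _ r _ | death _ r _ | cross _ r _ _ _ => r

/-- The orientations of the upper ends of the crossing, maximum or minimum. -/
def coreTop : Slice → List Bool
  | birth _ _ _ => []
  | death _ _ d => [d, !d]
  | cross _ _ a b _ => [a, b]

/-- The orientations of the lower ends of the crossing, maximum or minimum. -/
def coreBot : Slice → List Bool
  | birth _ _ d => [d, !d]
  | death _ _ _ => []
  | cross _ _ a b _ => [b, a]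

theorem top_eq (s : Slice) : s.top = s.left ++ (s.coreTop ++ s.right) := by
  cases s <;> rfl

theorem bot_eq (s : Slice) : s.bot = s.left ++ (s.coreBot ++ s.right) := by
  cases s <;> rfl

theorem joins_left (s : Slice) {i : ℕ} (hi : i < s.left.length) : s.Joins (.inl i) (.inr i) := by
  cases s <;> constructor <;> exact hi

theorem joins_right (s : Slice) (i : ℕ) :
    s.Joins (.inl (s.left.length + (s.coreTop.length + i)))
      (.inr (s.left.length + (s.coreBot.length + i))) := by
  rcases s with ⟨l, r, d⟩ | ⟨l, r, d⟩ | ⟨l, r, a, b, o⟩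
  · convert Joins.birth_right l r d (l.length + i) (by omega) using 2
    all_goals
      simp only [left, coreTop, coreBot, List.length_nil, List.length_cons]
      omega
  · convert Joins.death_right l r d (l.length + i) (by omega) using 2
    all_goals
      simp only [left, coreTop, coreBot, List.length_nil, List.length_cons]
      omega
  · exact .cross_right l r a b o (l.length + (2 + i)) (by omega)

variable {α : Type*}

/-- The coloring condition at the crossing, maximum or minimum of a strip, for the colored rows of
its upper and of its lower ends. The colors of a crossing satisfy `P`. -/
inductive CoreColored (P : Quad α → Prop) : Slice → List (Bool × α) → List (Bool × α) → Prop
  | birth (l r d x) : CoreColored P (.birth l r d) [] [(d, x), (!d, x)]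
  | death (l r d x) : CoreColored P (.death l r d) [(d, x), (!d, x)] []
  | cross (l r a b o x y z w) : P (Quad.ofEnds a b o x y z w) →
      CoreColored P (.cross l r a b o) [(a, x), (b, y)] [(b, z), (a, w)]

/-- The coloring condition on a strip with the colored rows `U` at the top and `V` at the bottom:
the colors are constant along strings, apart from the crossing, where they satisfy `P`. -/
def Colored (P : Quad α → Prop) (s : Slice) (U V : List (Bool × α)) : Prop :=
  ∃ L R M N, L.map Prod.fst = s.left ∧ R.map Prod.fst = s.right ∧
    U = L ++ (M ++ R) ∧ V = L ++ (N ++ R) ∧ s.CoreColored P M N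

/-- The color of a point on the boundary of a strip. -/
def colorAt (U V : List (Bool × α)) : ℕ ⊕ ℕ → Option α
  | .inl i => U[i]?.map Prod.snd
  | .inr i => V[i]?.map Prod.snd

variable {P : Quad α → Prop} {s : Slice} {U V : List (Bool × α)}

theorem CoreColored.map_fst (h : s.CoreColored P U V) :
    U.map Prod.fst = s.coreTop ∧ V.map Prod.fst = s.coreBot := by
  cases h <;> exact ⟨rfl, rfl⟩

theorem Colored.map_fst (h : s.Colored P U V) :
    U.map Prod.fst = s.top ∧ V.map Prod.fst = s.bot := by
  obtain ⟨L, R, M, N, hL, hR, rfl, rfl, hc⟩ := h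
  simp only [top_eq, bot_eq, List.map_append, hL, hR, hc.map_fst, and_self]

theorem Colored.colorAt_eq (h : s.Colored P U V) {e f : ℕ ⊕ ℕ} (hJ : s.Joins e f) :
    colorAt U V e = colorAt U V f := by
  obtain ⟨L, R, M, N, hL, -, rfl, rfl, hc⟩ := h
  cases hc <;> cases hJ <;> subst hL <;> simp_all [colorAt] <;> grind

theorem Colored.crossing {l r : List Bool} {a b o : Bool}
    (h : (Slice.cross l r a b o).Colored P U V) {x y z w : α}
    (hx : colorAt U V (.inl l.length) = some x) (hy : colorAt U V (.inl (l.length + 1)) = some y)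
    (hz : colorAt U V (.inr l.length) = some z) (hw : colorAt U V (.inr (l.length + 1)) = some w) :
    P (Quad.ofEnds a b o x y z w) := by
  obtain ⟨L, R, M, N, hL, -, rfl, rfl, hc⟩ := h
  obtain rfl : L.map Prod.fst = l := hL
  cases hc
  simp_all [colorAt]

theorem exists_append_of_colorAt_eq (hU : U.map Prod.fst = s.top) (hV : V.map Prod.fst = s.bot)
    (hJ : ∀ e f, s.Joins e f → colorAt U V e = colorAt U V f) :
    ∃ L R M N, L.map Prod.fst = s.left ∧ R.map Prod.fst = s.right ∧ U = L ++ (M ++ R) ∧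
      V = L ++ (N ++ R) ∧ M.map Prod.fst = s.coreTop ∧ N.map Prod.fst = s.coreBot := by
  rw [top_eq] at hU
  rw [bot_eq] at hV
  obtain ⟨L, U', rfl, hL, hU'⟩ := List.map_eq_append_iff.1 hU
  obtain ⟨M, R, rfl, hM, hR⟩ := List.map_eq_append_iff.1 hU'
  obtain ⟨L', V', rfl, hL', hV'⟩ := List.map_eq_append_iff.1 hV
  obtain ⟨N, R', rfl, hN, hR'⟩ := List.map_eq_append_iff.1 hV'
  have lL : L.length = s.left.length := by simp [← hL]
  have lL' : L'.length = s.left.length := by simp [← hL']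
  obtain rfl : L = L' := by
    refine eq_of_map_fst_eq_of_map_snd_eq (hL.trans hL'.symm)
      (List.ext_getElem (by simp [lL, lL']) fun i hi hi' => ?_)
    have hi : i < L.length := by simpa using hi
    have hi' : i < L'.length := by simpa using hi'
    have h := hJ _ _ (s.joins_left (lL ▸ hi))
    simp only [colorAt, List.getElem?_append_left hi, List.getElem?_append_left hi'] at h
    simpa only [List.getElem_map, List.getElem?_eq_getElem hi, List.getElem?_eq_getElem hi',
      Option.map_some, Option.some.injEq] using h
  obtain rfl : R = R' := by
    refine eq_of_map_fst_eq_of_map_snd_eq (hR.trans hR'.symm) (List.ext_getElem? fun i => ?_)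
    simpa [colorAt, ← hL, ← hM, ← hN, List.getElem?_append] using hJ _ _ (s.joins_right i)
  exact ⟨L, R, M, N, hL, hR, rfl, rfl, hM, hN⟩

theorem colored_of_colorAt_eq (hU : U.map Prod.fst = s.top) (hV : V.map Prod.fst = s.bot)
    (hJ : ∀ e f, s.Joins e f → colorAt U V e = colorAt U V f)
    (hP : ∀ l r a b o x y z w, s = cross l r a b o →
      colorAt U V (.inl l.length) = some x → colorAt U V (.inl (l.length + 1)) = some y →
      colorAt U V (.inr l.length) = some z → colorAt U V (.inr (l.length + 1)) = some w →
      P (Quad.ofEnds a b o x y z w)) : s.Colored P U V := by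
  obtain ⟨L, R, M, N, hL, hR, rfl, rfl, hM, hN⟩ := exists_append_of_colorAt_eq hU hV hJ
  refine ⟨L, R, M, N, hL, hR, rfl, rfl, ?_⟩
  have pair {K : List (Bool × α)} {a b : Bool} (h : K.map Prod.fst = [a, b]) :
      ∃ x y, K = [(a, x), (b, y)] := by
    match K, h with
    | [(_, x), (_, y)], rfl => exact ⟨x, y, rfl⟩
  cases s with
  | birth l r d =>
    obtain rfl := List.map_eq_nil_iff.1 hM
    obtain ⟨x, y, rfl⟩ := pair hN
    obtain rfl : L.map Prod.fst = l := hL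
    obtain rfl : x = y := by simpa [colorAt] using hJ _ _ (.birth_arch _ r d)
    exact .birth ..
  | death l r d =>
    obtain rfl := List.map_eq_nil_iff.1 hN
    obtain ⟨x, y, rfl⟩ := pair hM
    obtain rfl : L.map Prod.fst = l := hL
    obtain rfl : x = y := by simpa [colorAt] using hJ _ _ (.death_arch _ r d)
    exact .death ..
  | cross l r a b o =>
    obtain ⟨x, y, rfl⟩ := pair hM
    obtain ⟨z, w, rfl⟩ := pair hN
    obtain rfl : L.map Prod.fst = l := hL
    exact .cross _ _ _ _ _ x y z w (hP _ _ _ _ _ x y z w rfl (by simp [colorAt])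
      (by simp [colorAt]) (by simp [colorAt]) (by simp [colorAt]))

end Slice

theorem IsTangle.bot_eq {u v : List Bool} {L : List Slice} (h : IsTangle u L v) {j : ℕ}
    {s : Slice} (hs : L[j]? = some s) :
    (match L[j + 1]? with | some t => t.top | none => v) = s.bot := by
  induction L generalizing u j with
  | nil => simp at hs
  | cons t L ih =>
    cases j with
    | zero =>
      obtain rfl : t = s := by simpa using hs
      cases L with
      | nil => exact h.2.symm
      | cons t' L => exact h.2.1
    | succ j => exact ih h.2 hs

/-- The coloring conditions on a stack `L` of strips, for the colored rows `u j` on its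
horizontal lines. -/
def StackColored {α : Type*} (P : Quad α → Prop) (L : List Slice) (u : ℕ → List (Bool × α)) :
    Prop :=
  ∀ (j : ℕ) (s : Slice), L[j]? = some s → s.Colored P (u j) (u (j + 1))

namespace LinkDiagram

variable {D : LinkDiagram}

theorem row_eq_top {j : ℕ} {s : Slice} (hs : D.slices[j]? = some s) : D.row j = s.top := by
  simp [row, hs]

theorem row_eq_bot {j : ℕ} {s : Slice} (hs : D.slices[j]? = some s) : D.row (j + 1) = s.bot :=
  D.isTangle.bot_eq hs

theorem row_eq_nil {j : ℕ} (hj : D.slices.length ≤ j) : D.row j = [] := by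
  simp [row, List.getElem?_eq_none hj]

section Values

variable {α : Type*} (c : D.Point → α)

theorem length_coloredRow (j : ℕ) : (D.coloredRow c j).length = (D.row j).length :=
  List.length_ofFn

theorem map_fst_coloredRow (j : ℕ) : (D.coloredRow c j).map Prod.fst = D.row j := by
  simp [coloredRow, List.map_ofFn, Function.comp_def]

theorem map_coloredRow {β : Type*} (f : α → β) (j : ℕ) :
    (D.coloredRow c j).map (Prod.map id f) = D.coloredRow (fun p => f (c p)) j := by
  rw [coloredRow, List.map_ofFn]
  rfl

theorem coloredRow_getElem? (p : D.Point) :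
    (D.coloredRow c p.1.1)[p.1.2]? = some (D.down p, c p) := by
  simp only [coloredRow, List.getElem?_ofFn, p.2, dite_true]
  rfl

theorem coloredRow_injective : Function.Injective (D.coloredRow (X := α)) := by
  intro c c' h
  funext p
  have := coloredRow_getElem? c p
  rw [h, coloredRow_getElem?] at this
  exact (congrArg Prod.snd (Option.some.inj this)).symm

theorem colorAt_place {j : ℕ} {e : ℕ ⊕ ℕ} {p : D.Point} (h : p.1 = place j e) :
    Slice.colorAt (D.coloredRow c j) (D.coloredRow c (j + 1)) e = some (c p) := by
  have := coloredRow_getElem? c p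
  rw [h] at this
  cases e <;> simpa [Slice.colorAt, place] using congrArg (Option.map Prod.snd) this

theorem exists_point_of_colorAt {j : ℕ} {e : ℕ ⊕ ℕ} {x : α}
    (h : Slice.colorAt (D.coloredRow c j) (D.coloredRow c (j + 1)) e = some x) :
    ∃ p : D.Point, p.1 = place j e ∧ c p = x := by
  obtain ⟨p, hp⟩ : ∃ p : D.Point, p.1 = place j e := by
    cases e with
    | inl i | inr i =>
      refine ⟨⟨(_, i), ?_⟩, rfl⟩
      rw [← length_coloredRow c]
      by_contra hi
      simp [Slice.colorAt, List.getElem?_eq_none (not_lt.1 hi)] at h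
  rw [colorAt_place c hp] at h
  exact ⟨p, hp, Option.some.inj h⟩

theorem exists_point_iff_of_joins {j : ℕ} {s : Slice} (hs : D.slices[j]? = some s) {e f : ℕ ⊕ ℕ}
    (h : s.Joins e f) :
    (∃ p : D.Point, p.1 = place j e) ↔ ∃ p : D.Point, p.1 = place j f := by
  have key (m : ℕ × ℕ) : (∃ p : D.Point, p.1 = m) ↔ m.2 < (D.row m.1).length :=
    ⟨fun ⟨p, hp⟩ => hp ▸ p.2, fun hm => ⟨⟨m, hm⟩, rfl⟩⟩
  rw [key, key]
  cases h <;> simp [place, row_eq_top hs, row_eq_bot hs, Slice.top, Slice.bot] <;> omega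

theorem colorAt_eq_of_joined (hc : ∀ p q, D.Joined p q → c p = c q) {j : ℕ} {s : Slice}
    (hs : D.slices[j]? = some s) {e f : ℕ ⊕ ℕ} (hef : s.Joins e f) :
    Slice.colorAt (D.coloredRow c j) (D.coloredRow c (j + 1)) e =
      Slice.colorAt (D.coloredRow c j) (D.coloredRow c (j + 1)) f := by
  refine Option.ext fun x => ⟨fun h => ?_, fun h => ?_⟩
  · obtain ⟨p, hp, rfl⟩ := exists_point_of_colorAt c h
    obtain ⟨q, hq⟩ := (exists_point_iff_of_joins hs hef).1 ⟨p, hp⟩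
    rw [colorAt_place c hq, hc p q ⟨j, s, e, f, hs, hef, hp, hq⟩]
  · obtain ⟨q, hq, rfl⟩ := exists_point_of_colorAt c h
    obtain ⟨p, hp⟩ := (exists_point_iff_of_joins hs hef).2 ⟨q, hq⟩
    rw [colorAt_place c hp, hc p q ⟨j, s, e, f, hs, hef, hp, hq⟩]

variable (D) in
/-- The condition that the colors of the points of the diagram come from colors of the semi-arcs,
and that those at each crossing satisfy `P`. -/
def IsColoring (P : Quad α → Prop) (c : D.Point → α) : Prop :=
  (∀ p q, D.Joined p q → c p = c q) ∧ ∀ q, D.IsCrossing q → P (q.map c)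

variable {c} {P : Quad α → Prop}

theorem IsColoring.map {β : Type*} {P' : Quad β → Prop} (h : D.IsColoring P c) (f : α → β)
    (hP : ∀ q, P q → P' (q.map f)) : D.IsColoring P' (fun p => f (c p)) :=
  ⟨fun p q hpq => congrArg f (h.1 p q hpq), fun q hq => hP _ (h.2 q hq)⟩

theorem isColoring_iff : D.IsColoring P c ↔ StackColored P D.slices (D.coloredRow c) := by
  constructor
  · intro h j s hs
    refine Slice.colored_of_colorAt_eq ((map_fst_coloredRow c j).trans (row_eq_top hs))
      ((map_fst_coloredRow c (j + 1)).trans (row_eq_bot hs))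
      (fun e f hef => colorAt_eq_of_joined c h.1 hs hef) ?_
    rintro l r a b o x y z w rfl hx hy hz hw
    obtain ⟨tl, htl, rfl⟩ := exists_point_of_colorAt c hx
    obtain ⟨tr, htr, rfl⟩ := exists_point_of_colorAt c hy
    obtain ⟨bl, hbl, rfl⟩ := exists_point_of_colorAt c hz
    obtain ⟨br, hbr, rfl⟩ := exists_point_of_colorAt c hw
    rw [← Quad.map_ofEnds]
    exact h.2 _ ⟨j, l, r, a, b, o, tl, tr, bl, br, hs, htl, htr, hbl, hbr, rfl⟩
  · intro h
    constructor
    · rintro p q ⟨j, s, e, f, hs, hef, hp, hq⟩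
      have := (h j s hs).colorAt_eq hef
      rw [colorAt_place c hp, colorAt_place c hq] at this
      exact Option.some.inj this
    · rintro q ⟨j, l, r, a, b, o, tl, tr, bl, br, hs, htl, htr, hbl, hbr, rfl⟩
      rw [Quad.map_ofEnds]
      exact (h j _ hs).crossing (colorAt_place c htl) (colorAt_place c htr) (colorAt_place c hbl)
        (colorAt_place c hbr)

theorem exists_isColoring_coloredRow_eq {u : ℕ → List (Bool × α)}
    (h0 : ∀ j, D.slices.length ≤ j → u j = []) (hu : StackColored P D.slices u) :
    ∃ c, D.IsColoring P c ∧ D.coloredRow c = u := by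
  have hrow (j : ℕ) : D.row j = (u j).map Prod.fst := by
    by_cases hj : D.slices.length ≤ j
    · rw [row_eq_nil hj, h0 j hj]
      rfl
    · have hs := List.getElem?_eq_getElem (not_le.1 hj)
      rw [(hu j _ hs).map_fst.1, row_eq_top hs]
  have hc : D.coloredRow (fun p => ((u p.1.1)[p.1.2]'(by simpa [hrow] using p.2)).2) = u := by
    refine funext fun j => List.ext_getElem (by simp [coloredRow, hrow]) fun i _ _ => ?_
    simp [coloredRow, hrow]
  exact ⟨_, isColoring_iff.2 (hc.symm ▸ hu), hc⟩

end Values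

section Colorings

variable {X : Type*} [Biquandle X] {Q : Type*} [Quandle Q]

/-- The color of the semi-arc containing a point. -/
def BiquandleColoring.color (C : D.BiquandleColoring X) (p : D.Point) : X :=
  C.toFun (D.semiArc p)

/-- The color of the arc containing a point. -/
def QuandleColoring.color (C : D.QuandleColoring Q) (p : D.Point) : Q :=
  C.toFun (D.arc p)

theorem BiquandleColoring.isColoring (C : D.BiquandleColoring X) :
    D.IsColoring Quad.IsBiquandleColored C.color :=
  ⟨fun _ _ h => congrArg C.toFun (Quot.sound h), C.crossing⟩

theorem BiquandleColoring.color_injective :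
    Function.Injective (BiquandleColoring.color (D := D) (X := X)) := by
  rintro ⟨f, _⟩ ⟨g, _⟩ h
  obtain rfl : f = g := funext fun σ => Quot.inductionOn σ (congrFun h)
  rfl

/-- The biquandle coloring with given colors of the points. -/
def BiquandleColoring.ofPoints (c : D.Point → X) (h : D.IsColoring Quad.IsBiquandleColored c) :
    D.BiquandleColoring X where
  toFun := Quot.lift c h.1
  crossing := h.2

theorem exists_isCrossing_of_overJoined {p q : D.Point} (h : D.OverJoined p q) :
    ∃ r, D.IsCrossing r ∧ (r.j = p ∧ r.l = q ∨ r.j = q ∧ r.l = p) := by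
  obtain ⟨j, s, e, f, hs, hef, hp, hq⟩ := h
  have key {m : ℕ × ℕ} (hm : m.2 < (D.row m.1).length) : ∃ p : D.Point, p.1 = m := ⟨⟨m, hm⟩, rfl⟩
  rcases hef with ⟨l, r, a, b⟩ | ⟨l, r, a, b⟩
  · obtain ⟨tr, htr⟩ := key (m := (j, l.length + 1)) (by simp [row_eq_top hs, Slice.top])
    obtain ⟨bl, hbl⟩ := key (m := (j + 1, l.length)) (by simp [row_eq_bot hs, Slice.bot])
    refine ⟨_, ⟨j, l, r, a, b, true, p, tr, bl, q, hs, hp, htr, hbl, hq, rfl⟩, ?_⟩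
    cases a <;> cases b <;> simp [Quad.ofEnds]
  · obtain ⟨tl, htl⟩ := key (m := (j, l.length)) (by simp [row_eq_top hs, Slice.top])
    obtain ⟨br, hbr⟩ := key (m := (j + 1, l.length + 1)) (by simp [row_eq_bot hs, Slice.bot])
    refine ⟨_, ⟨j, l, r, a, b, false, tl, p, q, br, hs, htl, hp, hq, hbr, rfl⟩, ?_⟩
    cases a <;> cases b <;> simp [Quad.ofEnds]

theorem IsCrossing.overJoined {q : Quad D.Point} (h : D.IsCrossing q) :
    D.OverJoined q.j q.l ∨ D.OverJoined q.l q.j := by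
  obtain ⟨j, l, r, a, b, o, tl, tr, bl, br, hs, htl, htr, hbl, hbr, rfl⟩ := h
  cases o
  · have h : D.OverJoined tr bl := ⟨j, _, _, _, hs, .right .., htr, hbl⟩
    cases a
    · exact .inl h
    · exact .inr h
  · have h : D.OverJoined tl br := ⟨j, _, _, _, hs, .left .., htl, hbr⟩
    cases b
    · exact .inr h
    · exact .inl h

theorem QuandleColoring.isColoring (C : D.QuandleColoring Q) :
    D.IsColoring Quad.IsQuandleColored C.color := by
  refine ⟨fun _ _ h => congrArg (fun σ => C.toFun (D.proj σ)) (Quot.sound h), fun q hq => ?_⟩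
  refine ⟨C.crossing q hq, ?_⟩
  rcases hq.overJoined with h | h
  · exact congrArg C.toFun (Quot.sound (.inr h))
  · exact congrArg C.toFun (Quot.sound (.inr h)).symm

theorem QuandleColoring.color_injective :
    Function.Injective (QuandleColoring.color (D := D) (Q := Q)) := by
  rintro ⟨f, _⟩ ⟨g, _⟩ h
  obtain rfl : f = g := funext fun σ => Quot.inductionOn σ (congrFun h)
  rfl

/-- The quandle coloring with given colors of the points. -/
def QuandleColoring.ofPoints (c : D.Point → Q) (h : D.IsColoring Quad.IsQuandleColored c) :
    D.QuandleColoring Q where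
  toFun := Quot.lift c (by
    rintro p q (hpq | hpq)
    · exact h.1 p q hpq
    · obtain ⟨r, hr, ⟨rfl, rfl⟩ | ⟨rfl, rfl⟩⟩ := exists_isCrossing_of_overJoined hpq
      · exact (h.2 r hr).2
      · exact (h.2 r hr).2.symm)
  crossing q hq := (h.2 q hq).1

end Colorings

end LinkDiagram

/-! ### Labels of regions with values in a group -/

/-- The product of the group elements of the strings of a row, inverted for upward strings: the
increment along a horizontal line of a function on regions. -/
def holonomy {G : Type*} [Group G] (u : List (Bool × G)) : G :=
  (u.map fun s => if s.1 then s.2 else s.2⁻¹).prod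

theorem holonomy_append {G : Type*} [Group G] (u v : List (Bool × G)) :
    holonomy (u ++ v) = holonomy u * holonomy v := by
  simp [holonomy]

theorem Quad.IsBalanced.holonomy_eq {G : Type*} [Group G] {a b o : Bool} {x y z w : G}
    (h : (Quad.ofEnds a b o x y z w).IsBalanced) :
    holonomy [(a, x), (b, y)] = holonomy [(b, z), (a, w)] := by
  have h : if a then (if b then x * y = z * w else w * y = z * x) else
      if b then x * z = y * w else y * x = w * z := by
    cases a <;> cases b <;> cases o <;> first | exact h | exact h.symm
  cases a <;> cases b <;>
    simp only [holonomy, List.map_cons, List.map_nil, List.prod_cons, List.prod_nil, mul_one,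
      if_true, if_false, Bool.false_eq_true] at h ⊢
  · simpa using congrArg (·⁻¹) h
  · rwa [inv_mul_eq_iff_eq_mul, ← mul_assoc, eq_mul_inv_iff_mul_eq, eq_comm]
  · rwa [mul_inv_eq_iff_eq_mul, mul_assoc, eq_inv_mul_iff_mul_eq, eq_comm]
  · exact h

namespace Slice

theorem JoinsGaps.left_or_right {s : Slice} {e f : ℕ ⊕ ℕ} (h : s.JoinsGaps e f) :
    (∃ i ≤ s.left.length, e = .inl i ∧ f = .inr i) ∨
    ∃ i, e = .inl (s.left.length + (s.coreTop.length + i)) ∧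
      f = .inr (s.left.length + (s.coreBot.length + i)) := by
  rcases h with ⟨l, r, d, i, hi⟩ | ⟨l, r, d, i, hi⟩ | ⟨l, r, d, i, hi⟩ | ⟨l, r, d, i, hi⟩ |
    ⟨l, r, a, b, o, i, hi⟩ | ⟨l, r, a, b, o, i, hi⟩
  case birth_left | death_left | cross_left => exact .inl ⟨i, hi, rfl, rfl⟩
  case birth_right | death_right =>
    refine .inr ⟨i - l.length, congrArg _ ?_, congrArg _ ?_⟩ <;>
      simp only [left, coreTop, coreBot, List.length_cons, List.length_nil] <;> omega
  case cross_right =>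
    refine .inr ⟨i - l.length - 2, congrArg _ ?_, congrArg _ ?_⟩ <;>
      simp only [left, coreTop, coreBot, List.length_cons, List.length_nil] <;> omega

theorem joinsGaps_zero (s : Slice) : s.JoinsGaps (.inl 0) (.inr 0) := by
  cases s <;> constructor <;> exact Nat.zero_le _

variable {G : Type*} [Group G]

theorem CoreColored.holonomy_eq {s : Slice} {M N : List (Bool × G)}
    (h : s.CoreColored Quad.IsBalanced M N) : holonomy M = holonomy N := by
  cases h with
  | birth l r d x | death l r d x => cases d <;> simp [holonomy]
  | cross l r a b o x y z w h => exact h.holonomy_eq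

theorem Colored.holonomy_eq {s : Slice} {U V : List (Bool × G)}
    (h : s.Colored Quad.IsBalanced U V) {e f : ℕ ⊕ ℕ} (hef : s.JoinsGaps e f) :
    holonomy (e.elim U.take V.take) = holonomy (f.elim U.take V.take) := by
  obtain ⟨L, R, M, N, hL, -, rfl, rfl, hc⟩ := h
  rcases hef.left_or_right with ⟨i, hi, rfl, rfl⟩ | ⟨i, rfl, rfl⟩
  · rw [← hL, List.length_map] at hi
    simp only [Sum.elim_inl, Sum.elim_inr, List.take_append_of_le_length hi]
  · simp only [Sum.elim_inl, Sum.elim_inr, ← hL, ← hc.map_fst.1, ← hc.map_fst.2, List.length_map,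
      List.take_length_add_append, holonomy_append, hc.holonomy_eq]

end Slice

namespace LinkDiagram

variable {D : LinkDiagram}

theorem some_down_eq {j : ℕ} {s : Slice} (hs : D.slices[j]? = some s) (p : D.Point)
    {e : ℕ ⊕ ℕ} (hp : p.1 = place j e) :
    some (D.down p) = e.elim (s.top[·]?) (s.bot[·]?) := by
  rw [down, ← List.getElem?_eq_getElem, hp, ← row_eq_top hs, ← row_eq_bot hs]
  cases e <;> rfl

theorem leftRegion_eq {j : ℕ} {s : Slice} (hs : D.slices[j]? = some s) {e f : ℕ ⊕ ℕ}
    {p q : D.Point} (hp : p.1 = place j e) (hq : q.1 = place j f) (h : s.JoinsGaps e f) :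
    D.leftRegion p = D.leftRegion q :=
  Quot.sound ⟨j, s, e, f, hs, h, hp, hq⟩

theorem next_eq_place {j : ℕ} {e : ℕ ⊕ ℕ} {p : D.Point} (hp : p.1 = place j e) :
    (p.1.1, p.1.2 + 1) = place j (e.map (· + 1) (· + 1)) := by
  rw [hp]
  cases e <;> rfl

theorem rightRegion_eq {j : ℕ} {s : Slice} (hs : D.slices[j]? = some s) {e f : ℕ ⊕ ℕ}
    {p q : D.Point} (hp : p.1 = place j e) (hq : q.1 = place j f)
    (h : s.JoinsGaps (e.map (· + 1) (· + 1)) (f.map (· + 1) (· + 1))) :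
    D.rightRegion p = D.rightRegion q :=
  Quot.sound ⟨j, s, _, _, hs, h, next_eq_place hp, next_eq_place hq⟩

theorem rightRegion_eq_leftRegion {p q : D.Point} (h : q.1 = (p.1.1, p.1.2 + 1)) :
    D.rightRegion p = D.leftRegion q :=
  congrArg (Quot.mk D.GapJoined) (Subtype.ext h.symm)

theorem specified_eq_of_parallel {p q : D.Point} (hd : D.down p = D.down q)
    (hl : D.leftRegion p = D.leftRegion q) (hr : D.rightRegion p = D.rightRegion q) :
    D.specified p = D.specified q := by
  rw [specified, specified, hd, hl, hr]

theorem specified_eq_of_arch {p q : D.Point} (hd : D.down q = !D.down p)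
    (hm : D.rightRegion p = D.leftRegion q) (ho : D.leftRegion p = D.rightRegion q) :
    D.specified p = D.specified q := by
  rw [specified, specified, hd, hm, ho]
  cases D.down p <;> rfl

theorem specified_eq_of_joined {p q : D.Point} (h : D.Joined p q) :
    D.specified p = D.specified q := by
  obtain ⟨j, s, e, f, hs, hef, hp, hq⟩ := h
  have hdp := some_down_eq hs p hp
  have hdq := some_down_eq hs q hq
  have hj : j < D.slices.length := (List.getElem?_eq_some_iff.1 hs).1
  rcases hef with ⟨l, r, d, i, hi⟩ | ⟨l, r, d, i, hi⟩ | ⟨l, r, d⟩ | ⟨l, r, d, i, hi⟩ |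
    ⟨l, r, d, i, hi⟩ | ⟨l, r, d⟩ | ⟨l, r, a, b, o, i, hi⟩ | ⟨l, r, a, b, o, i, hi⟩
  case birth_arch =>
    let g : D.Gap := ⟨place j (.inl l.length), hj.le, by simp [place, row_eq_top hs, Slice.top]⟩
    refine specified_eq_of_arch ?_ (rightRegion_eq_leftRegion (hq.trans (by rw [hp]; rfl))) ?_
    · simp_all [Slice.bot]
    · exact (Quot.sound (a := g) ⟨j, _, _, _, hs, .birth_left _ _ _ _ le_rfl, rfl, hp⟩).symm.trans
        (Quot.sound ⟨j, _, _, _, hs, .birth_right _ _ _ _ le_rfl, rfl, next_eq_place hq⟩)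
  case death_arch =>
    let g : D.Gap := ⟨place j (.inr l.length), hj, by simp [place, row_eq_bot hs, Slice.bot]⟩
    refine specified_eq_of_arch ?_ (rightRegion_eq_leftRegion (hq.trans (by rw [hp]; rfl))) ?_
    · simp_all [Slice.top]
    · exact (Quot.sound (b := g) ⟨j, _, _, _, hs, .death_left _ _ _ _ le_rfl, hp, rfl⟩).trans
        (Quot.sound ⟨j, _, _, _, hs, .death_right _ _ _ _ le_rfl, next_eq_place hq, rfl⟩).symm
  case cross_right =>
    refine specified_eq_of_parallel ?_ (leftRegion_eq hs hp hq (.cross_right _ _ _ _ _ _ hi))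
      (rightRegion_eq hs hp hq (.cross_right _ _ _ _ _ _ (Nat.le_succ_of_le hi)))
    grind [Slice.top, Slice.bot]
  all_goals
    refine specified_eq_of_parallel ?_ (leftRegion_eq hs hp hq (by constructor; omega))
      (rightRegion_eq hs hp hq (by constructor; first | exact hi | exact Nat.le_succ_of_le hi))
    grind [Slice.top, Slice.bot]

theorem IsCrossing.regions_eq {q : Quad D.Point} (h : D.IsCrossing q) :
    D.specified q.i = D.specified q.j ∧ D.specified q.k = D.opposite q.j ∧
      D.specified q.l = D.opposite q.i := by
  obtain ⟨j, l, r, a, b, o, tl, tr, bl, br, hs, htl, htr, hbl, hbr, rfl⟩ := h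
  have hW : D.leftRegion bl = D.leftRegion tl :=
    (leftRegion_eq (e := .inl _) (f := .inr _) hs htl hbl (.cross_left _ _ _ _ _ _ le_rfl)).symm
  have hE : D.rightRegion br = D.rightRegion tr :=
    (rightRegion_eq (e := .inl _) (f := .inr _) hs htr hbr
      (.cross_right _ _ _ _ _ _ le_rfl)).symm
  have hN := rightRegion_eq_leftRegion (htr.trans (by rw [htl]))
  have hS := rightRegion_eq_leftRegion (hbr.trans (by rw [hbl]))
  have dtl : D.down tl = a := by simpa [Slice.top] using some_down_eq (e := .inl _) hs tl htl
  have dtr : D.down tr = b := by simpa [Slice.top] using some_down_eq (e := .inl _) hs tr htr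
  have dbl : D.down bl = b := by simpa [Slice.bot] using some_down_eq (e := .inr _) hs bl hbl
  have dbr : D.down br = a := by simpa [Slice.bot] using some_down_eq (e := .inr _) hs br hbr
  cases a <;> cases b <;> cases o <;>
    simp only [Quad.ofEnds, specified, opposite, dtl, dtr, dbl, dbr, hW, hE, hN, hS, if_true,
      if_false, Bool.false_eq_true, and_self]

/-- The function on regions with value `1` on the unbounded region that is multiplied by `w p` on
crossing the point `p` in the direction of the normal vector. -/
def regionLabel {G : Type*} [Group G] (w : D.Point → G) (hw : D.IsColoring Quad.IsBalanced w) :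
    D.Region → G :=
  Quot.lift (fun g => holonomy ((D.coloredRow w g.1.1).take g.1.2)) (by
    rintro g g' ⟨j, s, e, f, hs, hef, hg, hg'⟩
    have key {g : D.Gap} {e} (hg : g.1 = place j e) : (D.coloredRow w g.1.1).take g.1.2 =
        e.elim (D.coloredRow w j).take (D.coloredRow w (j + 1)).take := by
      rw [hg]
      cases e <;> rfl
    rw [key hg, key hg', (isColoring_iff.1 hw j s hs).holonomy_eq hef])

section RegionLabel

variable {G : Type*} [Group G] {w : D.Point → G} (hw : D.IsColoring Quad.IsBalanced w)

theorem regionLabel_unbounded : regionLabel w hw D.unbounded = 1 := rfl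

theorem regionLabel_rightRegion (p : D.Point) :
    regionLabel w hw (D.rightRegion p) =
      regionLabel w hw (D.leftRegion p) * if D.down p then w p else (w p)⁻¹ := by
  change holonomy ((D.coloredRow w p.1.1).take (p.1.2 + 1)) =
    holonomy ((D.coloredRow w p.1.1).take p.1.2) * _
  rw [List.take_add_one, coloredRow_getElem?, holonomy_append]
  simp [holonomy]

theorem regionLabel_specified (p : D.Point) :
    regionLabel w hw (D.specified p) =
      holonomy ((D.coloredRow w p.1.1).take (if D.down p then p.1.2 else p.1.2 + 1)) := by
  unfold specified
  cases D.down p <;> rfl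

theorem regionLabel_specified_mul (p : D.Point) :
    regionLabel w hw (D.specified p) * w p = regionLabel w hw (D.opposite p) := by
  unfold specified opposite
  cases h : D.down p <;> simp [regionLabel_rightRegion, h]

end RegionLabel

theorem region_induction {P : D.Region → Prop} (h0 : P D.unbounded)
    (h : ∀ p : D.Point, P (D.specified p) ↔ P (D.opposite p)) (r : D.Region) : P r := by
  have right (p : D.Point) : P (D.leftRegion p) → P (D.rightRegion p) := by
    have := h p
    unfold specified opposite at this
    split_ifs at this
    exacts [this.1, this.2]
  obtain ⟨⟨j, i⟩, hj, hi⟩ := r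
  change j ≤ _ at hj
  change i ≤ _ at hi
  induction i with
  | succ i ih => exact right ⟨(j, i), hi⟩ (ih (Nat.le_of_succ_le hi))
  | zero =>
    induction j with
    | zero => exact h0
    | succ j ih =>
      have e : D.GapJoined ⟨(j, 0), Nat.le_of_succ_le hj, Nat.zero_le _⟩ ⟨(j + 1, 0), hj, hi⟩ :=
        ⟨j, D.slices[j], .inl 0, .inr 0, List.getElem?_eq_getElem _, Slice.joinsGaps_zero _,
          rfl, rfl⟩
      exact (congrArg P (Quot.sound e)).mp (ih (Nat.le_of_succ_le hj) (Nat.zero_le _))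

theorem exists_path (r : D.Region) : ∃ γ, D.Path γ r :=
  region_induction (P := fun r => ∃ γ, D.Path γ r) ⟨[], .start⟩ (fun p =>
    ⟨fun ⟨γ, h⟩ => ⟨_, .along γ p h⟩, fun ⟨γ, h⟩ => ⟨_, .against γ p h⟩⟩) r

theorem region_ext {G : Type*} [Group G] {w : D.Point → G} {R R' : D.Region → G}
    (h0 : R D.unbounded = R' D.unbounded)
    (h : ∀ p, R (D.specified p) * w p = R (D.opposite p))
    (h' : ∀ p, R' (D.specified p) * w p = R' (D.opposite p)) : R = R' :=
  funext (region_induction h0 fun p => by rw [← h p, ← h' p, mul_left_inj])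

end LinkDiagram

/-! ### The two maps between colorings -/

namespace LinkDiagram

variable {D : LinkDiagram} {X : Type*} [Biquandle X] {Q : Type*} [Quandle Q]

/-- The region coloring `C^R` of a quandle coloring `C`. -/
def QuandleColoring.regionColor (C : D.QuandleColoring Q) : D.Region → AssocGroup Q :=
  regionLabel (fun p => AssocGroup.of (C.color p))
    (C.isColoring.map _ fun _ => Quad.IsQuandleColored.isBalanced)

theorem QuandleColoring.isRegionColoring (C : D.QuandleColoring Q) :
    IsRegionColoring C C.regionColor :=
  ⟨regionLabel_unbounded _, regionLabel_specified_mul _⟩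

theorem IsRegionColoring.eq {C : D.QuandleColoring Q} {R R' : D.Region → AssocGroup Q}
    (h : IsRegionColoring C R) (h' : IsRegionColoring C R') : R = R' :=
  region_ext (h.unbounded.trans h'.unbounded.symm) h.cross h'.cross

/-- The map `Ψ`: the biquandle coloring `ψ ∘ C^S` of a quandle coloring `C`. -/
noncomputable def QuandleColoring.toBiquandleColoring
    (C : D.QuandleColoring (DerivedQuandle X)) : D.BiquandleColoring X :=
  .ofPoints (fun p => psi (C.regionColor (D.specified p)) (C.color p)) <| by
    refine ⟨fun p q h => ?_, fun q hq => ?_⟩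
    · simp only [specified_eq_of_joined h, C.isColoring.1 p q h]
    · obtain ⟨hij, hkj, hli⟩ := hq.regions_eq
      have h := (C.isColoring.2 q hq).isBiquandleColored (C.regionColor (D.specified q.i))
      simp only [Quad.map] at h ⊢
      rwa [hkj, hli, ← C.isRegionColoring.cross, ← C.isRegionColoring.cross, ← hij]

theorem QuandleColoring.color_toBiquandleColoring (C : D.QuandleColoring (DerivedQuandle X))
    (p : D.Point) :
    C.toBiquandleColoring.color p = psi (C.regionColor (D.specified p)) (C.color p) := rfl

/-- The automorphism by which the color of a semi-arc changes when it is pushed out from a given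
region to the unbounded one. -/
noncomputable def BiquandleColoring.pushOutAut (C : D.BiquandleColoring X) :
    D.Region → starAut X :=
  regionLabel (fun p => (overAut (C.color p))⁻¹)
    (C.isColoring.map _ fun _ => Quad.IsBiquandleColored.isBalanced)

theorem BiquandleColoring.pushOutAut_specified_mul (C : D.BiquandleColoring X) (p : D.Point) :
    C.pushOutAut (D.specified p) * (overAut (C.color p))⁻¹ = C.pushOutAut (D.opposite p) :=
  regionLabel_specified_mul _ p

/-- The map `Φ`: every semi-arc is pushed out to the unbounded region. -/
noncomputable def BiquandleColoring.toQuandleColoring (C : D.BiquandleColoring X) :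
    D.QuandleColoring (DerivedQuandle X) :=
  .ofPoints (fun p => .ofBase (C.pushOutAut (D.specified p) • C.color p)) <| by
    refine ⟨fun p q h => ?_, fun q hq => ?_⟩
    · simp only [specified_eq_of_joined h, C.isColoring.1 p q h]
    · obtain ⟨hij, hkj, hli⟩ := hq.regions_eq
      have h := (C.isColoring.2 q hq).isQuandleColored (C.pushOutAut (D.specified q.i))
      simp only [Quad.map] at h ⊢
      rwa [hkj, hli, ← C.pushOutAut_specified_mul, ← C.pushOutAut_specified_mul, ← hij]

theorem BiquandleColoring.color_toQuandleColoring (C : D.BiquandleColoring X) (p : D.Point) :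
    (C.toQuandleColoring.color p).toBase = C.pushOutAut (D.specified p) • C.color p := rfl

theorem pushOutAut_toBiquandleColoring (C : D.QuandleColoring (DerivedQuandle X)) (r : D.Region) :
    C.toBiquandleColoring.pushOutAut r = (state (C.regionColor r))⁻¹ := by
  refine congrFun (region_ext (R' := fun r => (state (C.regionColor r))⁻¹) ?_
    C.toBiquandleColoring.pushOutAut_specified_mul fun p => ?_) r
  · simp only [C.isRegionColoring.unbounded, state_one, inv_one]
    rfl
  · rw [← C.isRegionColoring.cross p]
    exact (mul_inv_rev _ _).symm.trans (congrArg _ (state_mul_of_eq _ _).symm)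

theorem state_regionColor_toQuandleColoring (C : D.BiquandleColoring X) (r : D.Region) :
    state (C.toQuandleColoring.regionColor r) = (C.pushOutAut r)⁻¹ := by
  refine region_induction (P := fun r => state (C.toQuandleColoring.regionColor r) =
    (C.pushOutAut r)⁻¹) ?_ (fun p => ?_) r
  · exact state_one.trans inv_one.symm
  · rw [← C.toQuandleColoring.isRegionColoring.cross p, state_mul_of, ← C.pushOutAut_specified_mul,
      mul_inv_rev, inv_inv]
    have h : overAut (C.color p) * (C.pushOutAut (D.specified p))⁻¹ =
        shift (C.toQuandleColoring.color p).toBase (C.pushOutAut (D.specified p))⁻¹ := by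
      rw [C.color_toQuandleColoring]
      exact congrArg (overAut · * _) (inv_smul_smul _ _).symm
    rw [h]
    exact (Equiv.apply_eq_iff_eq _).symm

theorem toQuandleColoring_toBiquandleColoring (C : D.QuandleColoring (DerivedQuandle X)) :
    C.toBiquandleColoring.toQuandleColoring = C := by
  refine QuandleColoring.color_injective (funext fun p => ?_)
  change C.toBiquandleColoring.pushOutAut _ • C.toBiquandleColoring.color p = _
  rw [pushOutAut_toBiquandleColoring]
  exact inv_smul_smul _ _

theorem toBiquandleColoring_toQuandleColoring (C : D.BiquandleColoring X) :
    C.toQuandleColoring.toBiquandleColoring = C := by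
  refine BiquandleColoring.color_injective (funext fun p => ?_)
  rw [QuandleColoring.color_toBiquandleColoring, psi, state_regionColor_toQuandleColoring]
  exact inv_smul_smul _ _

theorem Path.pushOut_iff {C : D.BiquandleColoring X} {γ : List (Bool × D.Point)} {r : D.Region}
    (hγ : D.Path γ r) (y a : X) : PushOut C γ y a ↔ C.pushOutAut r • y = a := by
  induction hγ generalizing y with
  | start => exact ⟨fun h => by cases h; rfl, fun h => h ▸ .nil y⟩
  | along γ p _ ih =>
    rw [← C.pushOutAut_specified_mul, mul_smul, overAut_inv_smul, ← ih]
    constructor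
    · rintro (_ | ⟨_, _, _, _, z, _, _, hq, h⟩)
      have hz : overOp z (C.color p) = y := hq.2
      rwa [← hz, overInv_over]
    · exact fun h => .cons true p γ y _ (underOp (C.color p) _) a ⟨rfl, over_overInv _ _⟩ h
  | against γ p _ ih =>
    have hp : C.pushOutAut (D.specified p) • y =
        C.pushOutAut (D.opposite p) • overOp y (C.color p) := by
      rw [← C.pushOutAut_specified_mul, mul_smul, overAut_inv_smul, overInv_over]
    rw [hp, ← ih]
    constructor
    · rintro (_ | ⟨_, _, _, _, z, _, _, hq, h⟩)
      have hz : overOp y (C.color p) = z := hq.2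
      rwa [hz]
    · exact fun h => .cons false p γ y _ (underOp (C.color p) y) a ⟨rfl, rfl⟩ h

end LinkDiagram

/-! ### Colorings of the doubled diagram and of the diagram beside its mirror image -/

/-- A stack of strips can be colored with given colored rows at the top and at the bottom. -/
def Colorable {α : Type*} (P : Quad α → Prop) :
    List Slice → List (Bool × α) → List (Bool × α) → Prop
  | [], U, V => U = V
  | s :: L, U, V => ∃ W, s.Colored P U W ∧ Colorable P L W V

/-- A coloring of the stack of strips `L` is determined by its first and last row. -/
def IsRigid {α : Type*} (P : Quad α → Prop) (L : List Slice) : Prop :=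
  ∀ u u' : ℕ → List (Bool × α), StackColored P L u → StackColored P L u' →
    u 0 = u' 0 → u L.length = u' L.length → ∀ i ≤ L.length, u i = u' i

section Stack

variable {α : Type*} {P : Quad α → Prop} {L M : List Slice}

theorem stackColored_append {u : ℕ → List (Bool × α)} :
    StackColored P (L ++ M) u ↔
      StackColored P L u ∧ StackColored P M fun i => u (L.length + i) := by
  constructor
  · refine fun h => ⟨fun i s hs => h i s ?_, fun i s hs => h _ s ?_⟩
    · rw [List.getElem?_append_left (List.getElem?_eq_some_iff.1 hs).1, hs]
    · rw [List.getElem?_append_right (by simp), Nat.add_sub_cancel_left, hs]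
  · rintro ⟨hL, hM⟩ i s hs
    rw [List.getElem?_append] at hs
    split_ifs at hs with hi
    · exact hL i s hs
    · obtain ⟨i, rfl⟩ := Nat.exists_eq_add_of_le (not_lt.1 hi)
      exact hM i s (by simpa using hs)

theorem StackColored.congr {u v : ℕ → List (Bool × α)} (h : StackColored P L u)
    (huv : ∀ i ≤ L.length, u i = v i) : StackColored P L v := by
  intro i s hs
  have hi := (List.getElem?_eq_some_iff.1 hs).1
  rw [← huv i hi.le, ← huv (i + 1) hi]
  exact h i s hs

theorem StackColored.exists_append {u v : ℕ → List (Bool × α)} (hu : StackColored P L u)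
    (hv : StackColored P M v) (huv : u L.length = v 0) :
    ∃ w, w 0 = u 0 ∧ (∀ i, w (L.length + i) = v i) ∧ StackColored P (L ++ M) w := by
  let w (i : ℕ) := if i ≤ L.length then u i else v (i - L.length)
  have hw (i : ℕ) : w (L.length + i) = v i := by
    cases i <;> simp [w, huv]
  refine ⟨w, by simp [w], hw, stackColored_append.2 ⟨hu.congr fun i hi => by simp [w, hi], ?_⟩⟩
  simpa only [hw] using hv

theorem Colorable.exists_stackColored {U V : List (Bool × α)} (h : Colorable P L U V) :
    ∃ u : ℕ → List (Bool × α), u 0 = U ∧ u L.length = V ∧ StackColored P L u := by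
  induction L generalizing U with
  | nil => exact ⟨fun _ => U, rfl, h, fun i s hs => by simp at hs⟩
  | cons t L ih =>
    obtain ⟨W, hW, h⟩ := h
    obtain ⟨u, rfl, hV, hu⟩ := ih h
    refine ⟨fun i => i.casesOn U u, rfl, hV, fun i s hs => ?_⟩
    cases i with
    | zero =>
      obtain rfl : t = s := by simpa using hs
      exact hW
    | succ i => exact hu i s hs

variable {φ : Slice → List Slice}

theorem exists_stackColored_flatMap {d : ℕ → List (Bool × α)}
    (h0 : ∀ j, L.length ≤ j → d j = [])
    (h : ∀ j s, L[j]? = some s → Colorable P (φ s) (d j) (d (j + 1))) :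
    ∃ u, (∀ j, u ((L.take j).flatMap φ).length = d j) ∧
      (∀ i, (L.flatMap φ).length ≤ i → u i = []) ∧ StackColored P (L.flatMap φ) u := by
  induction L generalizing d with
  | nil => exact ⟨fun _ => [], fun j => by simp [h0], fun _ _ => rfl, fun i s hs => by simp at hs⟩
  | cons s L ih =>
    obtain ⟨v, hv, hv0, hvL⟩ := ih (d := fun j => d (j + 1))
      (fun j hj => h0 _ (by simpa using hj)) fun j t ht => h (j + 1) t (by simpa using ht)
    obtain ⟨u, hu0, hu1, hus⟩ := (h 0 s rfl).exists_stackColored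
    obtain ⟨w, hw0, hw, hwL⟩ := hus.exists_append hvL (hu1.trans (hv 0).symm)
    refine ⟨w, fun j => ?_, fun i hi => ?_, hwL⟩
    · cases j with
      | zero => exact hw0.trans hu0
      | succ j => rw [List.take_succ_cons, List.flatMap_cons, List.length_append, hw, hv]
    · rw [List.flatMap_cons, List.length_append] at hi
      obtain ⟨i, rfl⟩ := Nat.exists_eq_add_of_le (le_of_add_le_left hi)
      rw [hw, hv0 i (Nat.le_of_add_le_add_left hi)]

theorem eq_of_stackColored_flatMap (hφ : ∀ s, IsRigid P (φ s)) {u u' : ℕ → List (Bool × α)}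
    (hu : StackColored P (L.flatMap φ) u) (hu' : StackColored P (L.flatMap φ) u')
    (h : ∀ j, u ((L.take j).flatMap φ).length = u' ((L.take j).flatMap φ).length)
    (i : ℕ) (hi : i ≤ (L.flatMap φ).length) : u i = u' i := by
  induction L generalizing u u' i with
  | nil =>
    obtain rfl : i = 0 := by simpa using hi
    exact h 0
  | cons s L ih =>
    rw [List.flatMap_cons, stackColored_append] at hu hu'
    rw [List.flatMap_cons, List.length_append] at hi
    rcases le_total i (φ s).length with hi' | hi'
    · exact hφ s u u' hu.1 hu'.1 (h 0) (by simpa using h 1) i hi'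
    · obtain ⟨i, rfl⟩ := Nat.exists_eq_add_of_le hi'
      exact ih hu.2 hu'.2 (fun j => by simpa using h (j + 1)) i (Nat.le_of_add_le_add_left hi)

end Stack

section Unique

variable {α : Type*} {P : Quad α → Prop} {s : Slice} {U V : List (Bool × α)}

theorem Slice.Colored.eq_bot {V' : List (Bool × α)} (h : s.Colored P U V)
    (h' : s.Colored P U V')
    (hs : ∀ M N N', s.CoreColored P M N → s.CoreColored P M N' → N = N') : V = V' := by
  obtain ⟨L, R, M, N, hL, hR, rfl, rfl, hc⟩ := h
  obtain ⟨L', R', M', N', hL', hR', hU, rfl, hc'⟩ := h'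
  obtain ⟨rfl, hMR⟩ := List.append_inj hU (by simpa using congrArg List.length (hL.trans hL'.symm))
  obtain ⟨rfl, rfl⟩ := List.append_inj' hMR
    (by simpa using congrArg List.length (hR.trans hR'.symm))
  rw [hs _ _ _ hc hc']

theorem Slice.Colored.eq_top {U' : List (Bool × α)} (h : s.Colored P U V)
    (h' : s.Colored P U' V)
    (hs : ∀ M M' N, s.CoreColored P M N → s.CoreColored P M' N → M = M') : U = U' := by
  obtain ⟨L, R, M, N, hL, hR, rfl, rfl, hc⟩ := h
  obtain ⟨L', R', M', N', hL', hR', rfl, hV, hc'⟩ := h'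
  obtain ⟨rfl, hNR⟩ := List.append_inj hV (by simpa using congrArg List.length (hL.trans hL'.symm))
  obtain ⟨rfl, rfl⟩ := List.append_inj' hNR
    (by simpa using congrArg List.length (hR.trans hR'.symm))
  rw [hs _ _ _ hc hc']

variable {l r : List Bool}

theorem Slice.Colored.birth_unique {U' : List (Bool × α)} {d : Bool}
    (h : (Slice.birth l r d).Colored P U V) (h' : (Slice.birth l r d).Colored P U' V) :
    U = U' :=
  h.eq_top h' fun _ _ _ hc hc' => by cases hc; cases hc'; rfl

theorem Slice.Colored.death_unique {V' : List (Bool × α)} {d : Bool}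
    (h : (Slice.death l r d).Colored P U V) (h' : (Slice.death l r d).Colored P U V') :
    V = V' :=
  h.eq_bot h' fun _ _ _ hc hc' => by cases hc; cases hc'; rfl

theorem Slice.Colored.cross_unique {X : Type*} [Biquandle X] {U V V' : List (Bool × X)}
    {a b o : Bool} (h : (Slice.cross l r a b o).Colored Quad.IsBiquandleColored U V)
    (h' : (Slice.cross l r a b o).Colored Quad.IsBiquandleColored U V') : V = V' := by
  refine h.eq_bot h' fun _ _ _ hc hc' => ?_
  cases hc with | cross _ _ _ _ _ x y z w hq =>
  cases hc' with | cross _ _ _ _ _ _ _ z' w' hq' =>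
  obtain ⟨rfl, rfl⟩ := Quad.bottom_unique hq hq'
  rfl

theorem Slice.isRigid_double {X : Type*} [Biquandle X] (s : Slice) :
    IsRigid (α := X) Quad.IsBiquandleColored s.double := by
  intro u u' h h' h0 h1 i hi
  cases s with
  | birth l r d =>
    have e := (h 1 _ rfl).birth_unique (h1 ▸ h' 1 _ rfl)
    simp only [double, List.length_cons, List.length_nil] at hi
    interval_cases i
    exacts [h0, e, h1]
  | death l r d =>
    have e := (h 0 _ rfl).death_unique (h0 ▸ h' 0 _ rfl)
    simp only [double, List.length_cons, List.length_nil] at hi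
    interval_cases i
    exacts [h0, e, h1]
  | cross l r a b o =>
    have e₁ := (h 0 _ rfl).cross_unique (h0 ▸ h' 0 _ rfl)
    have e₂ := (h 1 _ rfl).cross_unique (e₁ ▸ h' 1 _ rfl)
    have e₃ := (h 2 _ rfl).cross_unique (e₂ ▸ h' 2 _ rfl)
    simp only [double, List.length_cons, List.length_nil] at hi
    interval_cases i
    exacts [h0, e₁, e₂, e₃, h1]

theorem Slice.isRigid_besideMirror {X : Type*} [Biquandle X] (s : Slice) :
    IsRigid (α := X) Quad.IsBiquandleColored s.besideMirror := by
  intro u u' h h' h0 h1 i hi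
  have e : u 1 = u' 1 := by
    cases s with
    | birth l r d => exact (h 1 _ rfl).birth_unique (h1 ▸ h' 1 _ rfl)
    | death l r d => exact (h 0 _ rfl).death_unique (h0 ▸ h' 0 _ rfl)
    | cross l r a b o => exact (h 0 _ rfl).cross_unique (h0 ▸ h' 0 _ rfl)
  simp only [besideMirror, List.length_cons, List.length_nil] at hi
  interval_cases i
  exacts [h0, e, h1]

end Unique

/-- The colored row of the doubled diagram in which both strings of each pair have the color of the
original string. -/
def doubleColors {X : Type*} (u : List (Bool × DerivedQuandle X)) : List (Bool × X) :=
  u.flatMap fun s => [(true, s.2.toBase), (false, s.2.toBase)]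

theorem map_fst_doubleColors {X : Type*} (u : List (Bool × DerivedQuandle X)) :
    (doubleColors u).map Prod.fst = doubleRow (u.map Prod.fst) := by
  simp [doubleColors, doubleRow, List.map_flatMap, List.flatMap_map]

theorem doubleColors_append {X : Type*} (u v : List (Bool × DerivedQuandle X)) :
    doubleColors (u ++ v) = doubleColors u ++ doubleColors v :=
  List.flatMap_append

theorem Quad.IsQuandleColored.exists_double {X : Type*} [Biquandle X] {a b o : Bool}
    {x y z w : DerivedQuandle X}
    (h : (Quad.ofEnds a b o x y z w).IsQuandleColored) : ∃ p q s t : X,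
      (Quad.ofEnds false true (doubleOver o (!a) b) x.toBase y.toBase p q).IsBiquandleColored ∧
      (Quad.ofEnds true true (doubleOver o a b) x.toBase p z.toBase s).IsBiquandleColored ∧
      (Quad.ofEnds false false (doubleOver o (!a) (!b)) q y.toBase t w.toBase).IsBiquandleColored ∧
      (Quad.ofEnds true false (doubleOver o a (!b)) s t z.toBase w.toBase).IsBiquandleColored := by
  have under_eq {x y z : DerivedQuandle X} (h : Shelf.act y x = z) :
      underOp x.toBase y.toBase = overOp z.toBase y.toBase := by
    rw [← h]
    exact (over_star x.toBase y.toBase).symm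
  cases a <;> cases b <;> cases o <;>
    simp only [Quad.IsQuandleColored, Quad.ofEnds, if_true, if_false, Bool.false_eq_true] at h <;>
    obtain ⟨h, rfl⟩ := h <;>
    simp only [Quad.IsBiquandleColored, Quad.ofEnds, doubleOver, Bool.not_true, Bool.not_false,
      if_true, if_false, Bool.false_eq_true] <;>
    refine ⟨_, _, _, _, ⟨rfl, rfl⟩, ⟨?_, ?_⟩, ⟨?_, ?_⟩, ⟨rfl, rfl⟩⟩ <;>
    first
    | rfl
    | exact under_eq h
    | exact (under_eq h).symm

theorem Slice.CoreColored.colorable_double {X : Type*} [Biquandle X] {s : Slice}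
    {M N : List (Bool × DerivedQuandle X)} (h : s.CoreColored Quad.IsQuandleColored M N)
    {L R : List (Bool × X)} (hL : L.map Prod.fst = doubleRow s.left)
    (hR : R.map Prod.fst = doubleRow s.right) :
    Colorable Quad.IsBiquandleColored s.double (L ++ (doubleColors M ++ R))
      (L ++ (doubleColors N ++ R)) := by
  cases h with
  | birth l r d x =>
    let x := x.toBase
    exact ⟨L ++ ([(true, x), (false, x)] ++ R), ⟨L, R, _, _, hL, hR, rfl, rfl, .birth _ _ _ x⟩, _,
      ⟨L ++ [(true, x)], (false, x) :: R, _, _, by simp [hL, left], by simp [hR, right],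
        by simp, rfl, .birth _ _ _ x⟩, by simp [x, doubleColors, Colorable]⟩
  | death l r d x =>
    let x := x.toBase
    exact ⟨L ++ ([(true, x), (false, x)] ++ R), ⟨L ++ [(true, x)], (false, x) :: R, _, _,
        by simp [hL, left], by simp [hR, right], by simp [x, doubleColors], by simp,
        .death _ _ _ x⟩, _,
      ⟨L, R, _, _, hL, hR, rfl, rfl, .death _ _ _ x⟩, rfl⟩
  | cross l r a b o x y z w h =>
    obtain ⟨p, q, s, t, h₁, h₂, h₃, h₄⟩ := h.exists_double
    let x := x.toBase
    let y := y.toBase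
    let z := z.toBase
    let w := w.toBase
    exact ⟨L ++ ([(true, x), (true, p), (false, q), (false, y)] ++ R),
      ⟨L ++ [(true, x)], (false, y) :: R, _, _, by simp [hL, left], by simp [hR, right],
        by simp [x, y, doubleColors], by simp [x, y], .cross _ _ _ _ _ _ _ _ _ h₁⟩,
      L ++ ([(true, z), (true, s), (false, q), (false, y)] ++ R),
      ⟨L, (false, q) :: (false, y) :: R, _, _, hL, by simp [hR, right],
        by simp [x], by simp [z], .cross _ _ _ _ _ _ _ _ _ h₂⟩,
      L ++ ([(true, z), (true, s), (false, t), (false, w)] ++ R),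
      ⟨L ++ [(true, z), (true, s)], R, _, _, by simp [hL, left], hR,
        by simp [y], by simp [w], .cross _ _ _ _ _ _ _ _ _ h₃⟩, _,
      ⟨L ++ [(true, z)], (false, w) :: R, _, _, by simp [hL, left], by simp [hR, right],
        by simp, rfl, .cross _ _ _ _ _ _ _ _ _ h₄⟩, by simp [z, w, doubleColors, Colorable]⟩

theorem Slice.Colored.colorable_double {X : Type*} [Biquandle X] {s : Slice}
    {U V : List (Bool × DerivedQuandle X)} (h : s.Colored Quad.IsQuandleColored U V) :
    Colorable Quad.IsBiquandleColored s.double (doubleColors U) (doubleColors V) := by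
  obtain ⟨L, R, M, N, hL, hR, rfl, rfl, hc⟩ := h
  simp only [doubleColors_append]
  exact hc.colorable_double (hL ▸ map_fst_doubleColors L) (hR ▸ map_fst_doubleColors R)

/-- The colored row of the mirror image with the opposite orientation. -/
def mirrorColors {X : Type*} (u : List (Bool × X)) : List (Bool × X) :=
  (u.map fun s => (!s.1, s.2)).reverse

theorem mirrorColors_cons {α : Type*} (s : Bool × α) (u : List (Bool × α)) :
    mirrorColors (s :: u) = mirrorColors u ++ [(!s.1, s.2)] := by
  simp [mirrorColors]

theorem map_fst_mirrorColors {X : Type*} (u : List (Bool × X)) :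
    (mirrorColors u).map Prod.fst = mirrorRow (u.map Prod.fst) := by
  simp [mirrorColors, mirrorRow, Function.comp_def]

theorem Quad.ofEnds_mirror {α : Type*} (a b o : Bool) (x y z w : α) :
    Quad.ofEnds (!b) (!a) (!o) y x w z = Quad.ofEnds a b o x y z w := by
  cases a <;> cases b <;> cases o <;> rfl

section Mirror

variable {α : Type*} {P : Quad α → Prop} {s : Slice} {U V : List (Bool × α)}

theorem Slice.Colored.addRight (h : s.Colored P U V) (W : List (Bool × α)) :
    (s.addRight (W.map Prod.fst)).Colored P (U ++ W) (V ++ W) := by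
  obtain ⟨L, R, M, N, hL, hR, rfl, rfl, hc⟩ := h
  refine ⟨L, R ++ W, M, N, ?_, ?_, by simp, by simp, ?_⟩
  · cases s <;> exact hL
  · rw [List.map_append, hR]
    cases s <;> rfl
  · cases hc <;> constructor
    assumption

theorem Slice.Colored.mirror (h : s.Colored P U V) (W : List (Bool × α)) :
    (s.mirror (W.map Prod.fst)).Colored P (W ++ mirrorColors U) (W ++ mirrorColors V) := by
  obtain ⟨L, R, M, N, hL, hR, rfl, rfl, hc⟩ := h
  refine ⟨W ++ mirrorColors R, mirrorColors L, mirrorColors M, mirrorColors N, ?_, ?_,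
    by simp [mirrorColors], by simp [mirrorColors], ?_⟩
  · rw [List.map_append, map_fst_mirrorColors, hR]
    cases s <;> rfl
  · rw [map_fst_mirrorColors, hL]
    cases s <;> rfl
  · cases hc with
    | birth l r d x => simpa [mirrorColors, Slice.mirror] using CoreColored.birth _ _ d x
    | death l r d x => simpa [mirrorColors, Slice.mirror] using CoreColored.death _ _ d x
    | cross l r a b o x y z w hq => exact .cross _ _ _ _ _ y x w z (by rwa [Quad.ofEnds_mirror])

theorem Slice.Colored.colorable_besideMirror (h : s.Colored P U V) :
    Colorable P s.besideMirror (U ++ mirrorColors U) (V ++ mirrorColors V) := by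
  refine ⟨V ++ mirrorColors U, ?_, V ++ mirrorColors V, ?_, rfl⟩
  · rw [← h.map_fst.1, ← map_fst_mirrorColors]
    exact h.addRight _
  · rw [← h.map_fst.2]
    exact h.mirror V

end Mirror

namespace LinkDiagram

variable {D : LinkDiagram} {X : Type*} [Biquandle X]

theorem coloredRow_eq_nil {α : Type*} (c : D.Point → α) {j : ℕ} (hj : D.slices.length ≤ j) :
    D.coloredRow c j = [] := by
  rw [← List.map_eq_nil_iff, map_fst_coloredRow, row_eq_nil hj]

theorem existsUnique_biquandleColoring_of_flatMap {D' : LinkDiagram} {φ : Slice → List Slice}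
    (hD' : D'.slices = D.slices.flatMap φ) {d : ℕ → List (Bool × X)}
    (h0 : ∀ j, D.slices.length ≤ j → d j = [])
    (h : ∀ j s, D.slices[j]? = some s →
      Colorable Quad.IsBiquandleColored (φ s) (d j) (d (j + 1)))
    (hφ : ∀ s, IsRigid (α := X) Quad.IsBiquandleColored (φ s)) :
    ∃! C : D'.BiquandleColoring X, ∀ j, C.row ((D.slices.take j).flatMap φ).length = d j := by
  obtain ⟨u, hu, hu0, huD⟩ := exists_stackColored_flatMap h0 h
  rw [← hD'] at hu0 huD
  obtain ⟨c, hc, rfl⟩ := exists_isColoring_coloredRow_eq hu0 huD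
  refine ⟨.ofPoints c hc, hu, fun C hC => ?_⟩
  refine BiquandleColoring.color_injective (coloredRow_injective (funext fun i => ?_))
  rcases le_total D'.slices.length i with hi | hi
  · rw [coloredRow_eq_nil _ hi, coloredRow_eq_nil _ hi]
  · exact eq_of_stackColored_flatMap hφ (hD' ▸ isColoring_iff.1 C.isColoring) (hD' ▸ huD)
      (fun j => (hC j).trans (hu j).symm) i (hD' ▸ hi)

theorem existsUnique_isDoubled (C : D.QuandleColoring (DerivedQuandle X)) :
    ∃! C₁ : D.double.BiquandleColoring X, IsDoubled C C₁ :=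
  existsUnique_biquandleColoring_of_flatMap (d := fun j => doubleColors (C.row j)) rfl
    (fun _ hj => congrArg doubleColors (coloredRow_eq_nil C.color hj))
    (fun j s hs => (isColoring_iff.1 C.isColoring j s hs).colorable_double) Slice.isRigid_double

theorem row_besideMirror_eq (C : D.besideMirror.BiquandleColoring X) (j : ℕ) :
    C.row (2 * j) = C.row ((D.slices.take j).flatMap Slice.besideMirror).length := by
  have length_flatMap (L : List Slice) : (L.flatMap Slice.besideMirror).length = 2 * L.length := by
    simp [List.length_flatMap, Slice.besideMirror, mul_comm]
  rw [length_flatMap, List.length_take]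
  rcases le_total j D.slices.length with hj | hj
  · rw [min_eq_left hj]
  · have hD : D.besideMirror.slices.length = 2 * D.slices.length := length_flatMap D.slices
    rw [min_eq_right hj]
    exact (coloredRow_eq_nil C.color (by omega)).trans (coloredRow_eq_nil C.color hD.le).symm

theorem existsUnique_row_besideMirror_eq (C : D.BiquandleColoring X) :
    ∃! C₂ : D.besideMirror.BiquandleColoring X,
      ∀ j, C₂.row (2 * j) = C.row j ++ mirrorColors (C.row j) := by
  simp only [row_besideMirror_eq]
  refine existsUnique_biquandleColoring_of_flatMap rfl (fun j hj => ?_)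
    (fun j s hs => (isColoring_iff.1 C.isColoring j s hs).colorable_besideMirror)
    Slice.isRigid_besideMirror
  have hC : C.row j = [] := coloredRow_eq_nil C.color hj
  rw [hC]
  rfl

end LinkDiagram

/-! ### Pulling away -/

section PullAway

variable {X : Type*} [Biquandle X]

/-- The row of the doubled diagram for the colored row `u`, with the colors transformed by `f`. -/
def strands (f : starAut X) (u : List (Bool × DerivedQuandle X)) : List (Strand X) :=
  u.flatMap fun s => [⟨s.1, true, f • s.2.toBase⟩, ⟨!s.1, false, f • s.2.toBase⟩]

theorem strands_one (u : List (Bool × DerivedQuandle X)) :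
    strands 1 u = List.zipWith (fun f s => (⟨f, s.1, s.2⟩ : Strand X))
      (frontTags (u.map Prod.fst)) (doubleColors u) := by
  induction u with
  | nil => rfl
  | cons s u ih =>
    simp only [frontTags, doubleColors, strands, List.map_cons, List.flatMap_cons,
      List.cons_append, List.nil_append, List.zipWith_cons_cons, one_smul] at ih ⊢
    rw [ih]

theorem slide_up_strands (x : X) (f : starAut X) (u : List (Bool × DerivedQuandle X)) :
    Slide false x (strands f u) (strands (overAut x * f) u) x := by
  induction u with
  | nil => exact .nil x
  | cons s u ih =>
    refine .cons x (underOp x (f • s.2.toBase)) x _ _ _ _ ⟨rfl, ?_⟩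
      (.cons _ x x _ _ _ _ ⟨rfl, ?_⟩ ih) <;> simp [Quad.ofEnds, mul_smul]

theorem slide_down_strands (x : X) (f : starAut X) (u : List (Bool × DerivedQuandle X)) :
    Slide true x (strands f u) (strands ((overAut x)⁻¹ * f) u) x := by
  induction u with
  | nil => exact .nil x
  | cons s u ih =>
    refine .cons x (underOp x (overInv (f • s.2.toBase) x)) x _ _ _ _ ⟨?_, ?_⟩
      (.cons _ x x _ _ _ _ ⟨?_, ?_⟩ ih) <;> simp [Quad.ofEnds, mul_smul, over_overInv]

/-- The colors of `ψ ∘ C^S` on a horizontal line, when `u` is the row of `C` to the right of a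
point in a region with the label `p`. -/
noncomputable def shadowRow (p : AssocGroup (DerivedQuandle X)) :
    List (Bool × DerivedQuandle X) → List (Bool × X)
  | [] => []
  | (true, b) :: u => (true, psi p b) :: shadowRow (p * .of b) u
  | (false, b) :: u =>
    (false, psi (p * (AssocGroup.of b)⁻¹) b) :: shadowRow (p * (AssocGroup.of b)⁻¹) u

theorem pullAway_strands (p : AssocGroup (DerivedQuandle X))
    (u : List (Bool × DerivedQuandle X)) :
    PullAway (strands (state p) u) (shadowRow p u) (mirrorColors (shadowRow p u)) := by
  induction u generalizing p with
  | nil => exact .nil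
  | cons s u ih =>
    obtain ⟨_ | _, b⟩ := s
    · have hslide : Slide true (psi p b) (⟨true, false, psi p b⟩ :: strands (state p) u)
          (⟨true, false, k (psi p b)⟩ :: strands (state (p * (AssocGroup.of b)⁻¹)) u)
          (k (psi p b)) := by
        rw [state_mul_of_inv_eq]
        exact .cons _ (k (psi p b)) _ _ _ _ _
          ⟨by simp [Quad.ofEnds, under_self, over_k_k], by simp [Quad.ofEnds, over_k_k]⟩
          (slide_down_strands _ _ u)
      rw [shadowRow, mirrorColors_cons, psi_mul_of_inv_self]
      exact .back _ _ _ _ _ _ _ hslide (.front _ _ _ _ _ (ih _))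
    · have hslide : Slide false (psi p b) (strands (state p) u)
          (strands (state (p * .of b)) u) (psi p b) := by
        rw [state_mul_of_eq]
        exact slide_up_strands _ _ u
      rw [shadowRow, mirrorColors_cons]
      exact .front _ _ _ _ _ (.back _ _ _ _ _ _ _ hslide (ih _))

theorem shadowRow_getElem? (p : AssocGroup (DerivedQuandle X))
    (u : List (Bool × DerivedQuandle X)) (i : ℕ) :
    (shadowRow p u)[i]? = u[i]?.map fun s => (s.1, psi (p * holonomy
      ((u.take (if s.1 then i else i + 1)).map (Prod.map id AssocGroup.of))) s.2) := by
  induction u generalizing p i with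
  | nil => rfl
  | cons s u ih =>
    cases i with
    | zero => obtain ⟨_ | _, b⟩ := s <;> simp [shadowRow, holonomy]
    | succ i =>
      obtain ⟨_ | _, b⟩ := s <;> simp only [shadowRow, List.getElem?_cons_succ, ih] <;>
        refine Option.map_congr fun s _ => ?_ <;>
        cases h : s.1 <;> simp [holonomy, mul_assoc]

theorem Slide.unique {d : Bool} {x y y' : X} {u v v' : List (Strand X)} (h : Slide d x u v y)
    (h' : Slide d x u v' y') : v = v' ∧ y = y' := by
  induction h generalizing v' with
  | nil x =>
    cases h'
    exact ⟨rfl, rfl⟩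
  | cons x x' y t c u u' hq _ ih =>
    cases h' with
    | cons _ x'' _ _ c' _ u'' hq' h' =>
    obtain ⟨rfl, rfl⟩ := Quad.bottom_unique hq hq'
    obtain ⟨rfl, rfl⟩ := ih h'
    exact ⟨rfl, rfl⟩

theorem PullAway.unique {u : List (Strand X)} {F B F' B' : List (Bool × X)}
    (h : PullAway u F B) (h' : PullAway u F' B') : F = F' ∧ B = B' := by
  induction h generalizing F' B' with
  | nil =>
    cases h'
    exact ⟨rfl, rfl⟩
  | front d x u F B _ ih =>
    cases h' with
    | front _ _ _ _ _ h' =>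
    obtain ⟨rfl, rfl⟩ := ih h'
    exact ⟨rfl, rfl⟩
  | back d x y u v F B hs _ ih =>
    cases h' with
    | back _ _ _ _ _ _ _ hs' h' =>
    obtain ⟨rfl, rfl⟩ := hs.unique hs'
    obtain ⟨rfl, rfl⟩ := ih h'
    exact ⟨rfl, rfl⟩

end PullAway

namespace LinkDiagram

variable {D : LinkDiagram} {X : Type*} [Biquandle X]

theorem row_toBiquandleColoring (C : D.QuandleColoring (DerivedQuandle X)) (j : ℕ) :
    C.toBiquandleColoring.row j = shadowRow 1 (C.row j) := by
  refine List.ext_getElem? fun i => ?_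
  rw [shadowRow_getElem?]
  rcases lt_or_ge i (D.row j).length with hi | hi
  · let p : D.Point := ⟨(j, i), hi⟩
    have hC : (C.row j)[i]? = some (D.down p, C.color p) := coloredRow_getElem? C.color p
    have hC' : (C.toBiquandleColoring.row j)[i]? =
        some (D.down p, C.toBiquandleColoring.color p) := coloredRow_getElem? _ p
    have hR : C.regionColor (D.specified p) = holonomy
        (((C.row j).take (if D.down p then i else i + 1)).map (Prod.map id AssocGroup.of)) := by
      have hrow : (C.row j).map (Prod.map id AssocGroup.of) =
          D.coloredRow (fun p => AssocGroup.of (C.color p)) j := map_coloredRow C.color _ j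
      rw [List.map_take, hrow]
      exact regionLabel_specified _ p
    rw [hC, hC', Option.map_some, one_mul, C.color_toBiquandleColoring, hR]
  · have hC : (C.row j)[i]? = none := List.getElem?_eq_none ((length_coloredRow _ j).trans_le hi)
    have hC' : (C.toBiquandleColoring.row j)[i]? = none :=
      List.getElem?_eq_none ((length_coloredRow _ j).trans_le hi)
    rw [hC, hC', Option.map_none]

theorem exists_double_pullAway_restrict (C : D.QuandleColoring (DerivedQuandle X)) :
    ∃ (C₁ : D.double.BiquandleColoring X) (C₂ : D.besideMirror.BiquandleColoring X),
      (IsDoubled C C₁ ∧ ∀ C', IsDoubled C C' → C' = C₁) ∧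
      (IsPulledAway C₁ C₂ ∧ ∀ C', IsPulledAway C₁ C' → C' = C₂) ∧
      IsRestriction C₂ C.toBiquandleColoring := by
  obtain ⟨C₁, h₁, unique₁⟩ := existsUnique_isDoubled C
  obtain ⟨C₂, h₂, unique₂⟩ := existsUnique_row_besideMirror_eq C.toBiquandleColoring
  have hp (j : ℕ) : PullAway (List.zipWith (fun f s => (⟨f, s.1, s.2⟩ : Strand X))
      (frontTags (D.row j)) (C₁.row (D.doubleLevel j))) (C.toBiquandleColoring.row j)
      (mirrorColors (C.toBiquandleColoring.row j)) := by
    have hD : D.row j = (C.row j).map Prod.fst := (map_fst_coloredRow _ j).symm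
    rw [h₁ j, hD, row_toBiquandleColoring]
    exact strands_one (C.row j) ▸ state_one (X := X) ▸ pullAway_strands 1 (C.row j)
  refine ⟨C₁, C₂, ⟨h₁, unique₁⟩, ⟨fun j => ⟨_, _, hp j, h₂ j⟩, fun C₃ h₃ => unique₂ C₃ fun j => ?_⟩,
    fun j => ?_⟩
  · obtain ⟨F, B, hFB, hrow⟩ := h₃ j
    obtain ⟨rfl, rfl⟩ := hFB.unique (hp j)
    exact hrow
  · have hD : (C.toBiquandleColoring.row j).length = (D.row j).length := length_coloredRow _ j
    rw [h₂, ← hD, List.take_left]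

end LinkDiagram

open LinkDiagram

theorem theorem3p1 {X : Type*} [Biquandle X] (D : LinkDiagram) :
    ∃ (Ψ : D.QuandleColoring (DerivedQuandle X) → D.BiquandleColoring X)
      (Φ : D.BiquandleColoring X → D.QuandleColoring (DerivedQuandle X)),
      -- the two maps are mutually inverse
      Function.LeftInverse Φ Ψ ∧ Function.RightInverse Φ Ψ ∧
      -- the map `Ψ` is: double, pull away, restrict
      (∀ C : D.QuandleColoring (DerivedQuandle X),
        ∃ (C₁ : D.double.BiquandleColoring X) (C₂ : D.besideMirror.BiquandleColoring X),
          (LinkDiagram.IsDoubled C C₁ ∧ ∀ C', LinkDiagram.IsDoubled C C' → C' = C₁) ∧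
          (LinkDiagram.IsPulledAway C₁ C₂ ∧ ∀ C', LinkDiagram.IsPulledAway C₁ C' → C' = C₂) ∧
          LinkDiagram.IsRestriction C₂ (Ψ C)) ∧
      -- the map `Φ` is: push out to the unbounded region, along any arc
      (∀ (C : D.BiquandleColoring X) (p : D.Point),
        (∃ γ, D.Path γ (D.specified p)) ∧
        ∀ γ, D.Path γ (D.specified p) → ∀ a : X,
          LinkDiagram.PushOut C γ (C.toFun (D.semiArc p)) a ↔
            ((Φ C).toFun (D.arc p)).toBase = a) ∧
      -- the map `Ψ` is the composite of the shadow coloring with `ψ`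
      (∃ ψ : AssocGroup (DerivedQuandle X) → DerivedQuandle X → X,
        IsPsi ψ ∧ (∀ ψ', IsPsi ψ' → ψ' = ψ) ∧
        ∀ C : D.QuandleColoring (DerivedQuandle X),
          ∃ R : D.Region → AssocGroup (DerivedQuandle X),
            LinkDiagram.IsRegionColoring C R ∧
            (∀ R', LinkDiagram.IsRegionColoring C R' → R' = R) ∧
            ∀ p : D.Point,
              (Ψ C).toFun (D.semiArc p) = ψ (R (D.specified p)) (C.toFun (D.arc p))) := by
  refine ⟨QuandleColoring.toBiquandleColoring, BiquandleColoring.toQuandleColoring,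
    toQuandleColoring_toBiquandleColoring, toBiquandleColoring_toQuandleColoring,
    exists_double_pullAway_restrict, fun C p => ?_, psi, isPsi_psi,
    fun _ h => h.eq isPsi_psi, fun C => ?_⟩
  · exact ⟨exists_path _, fun γ hγ a => hγ.pushOut_iff _ a⟩
  · exact ⟨C.regionColor, C.isRegionColoring, fun _ h => h.eq C.isRegionColoring,
      C.color_toBiquandleColoring⟩
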